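/- Let $\Lambda$ be a left Artinian ring (for instance an Artin algebra), $\mathsf{mod}\,\Lambda$ the category of finitely generated left $\Lambda$-modules, and $C^b(\Lambda)$ the category of bounded chain complexes over $\mathsf{mod}\,\Lambda$ (with chain maps as morphisms). A projective cover is an essential epimorphism from a projective object, and a syzygy $\Omega$ of an object is the kernel of a projective cover of it. **Truncated projective resolutions.** Let $m\ge 1$ and let $M\in\mathsf{mod}\,\Lambda$ have projective dimension at least $m$. Let $f_0:P_0\to M$ be a projective cover and put $R_0=M$. For $1\le i<m$ choose a direct sum decomposition $\ker(P_{i-1}\to R_{i-1})=Q_i\oplus R_i$ with $R_i\ne 0$ and a projective cover $P_i\to R_i$; let $f_i:P_i\to R_i\subseteq P_{i-1}$ be the composite. Let $Q_m=\ker(P_{m-1}\to R_{m-1})$. Write $i_k:Q_k\hookrightarrow P_{k-1}$ for the inclusion, and put $P_k=0$ for $k\ge m$ and $Q_k=0$ for $k>m$. The complex $X$ with $X_{-1}=M$, $X_0=P_0$, $X_k=Q_k\oplus P_k$ for $k\ge 1$ (and $0$ in the other degrees), with differentials $d_0=f_0$, $d_1(x,y)=i_1x+f_1y$ and $d_k(x,y)=(0,\,i_kx+f_ky)$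 for $k\ge2$, is called a truncated (minimal) projective resolution of $M$ of length $m$ with split-off summands $Q_1,\dots,Q_m$. By convention, the complex $N\xleftarrow{1}N$ in degrees $-1,0$ is the truncated projective resolution of $N$ of length $0$. Let $X$ be such a complex, let $q_k:P_{Q_k}\to Q_k$ be projective covers, $\Omega Q_k=\ker q_k$ with inclusion $j_k:\Omega Q_k\hookrightarrow P_{Q_k}$, and $\Omega M=\ker f_0$. Then the following hold. 1. Let $P_X$ be the complex with $P_0$ in degree $-1$, $P_0\oplus(P_{Q_1}\oplus P_1)$ in degree $0$, and $(P_{Q_k}\oplus P_k)\oplus(P_{Q_{k+1}}\oplus P_{k+1})$ in degree $k\ge1$, whose differential maps the first half of each degree identically onto the second half of the degree below it (onto $P_0$ when that degree is $-1$), and is zero on the second half. Then the map $g:P_X\to X$ with $g_{-1}=f_0$, $g_0(a,(c,d))=a+i_1q_1c+f_1d$ and $$g_k((a,b),(c,d))=(q_ka,\ b+i_{k+1}q_{k+1}c+f_{k+1}d)\qquad(k\ge1)$$ is a projective cover of $X$ in $C^b(\Lambda)$. 2. Let $\Omega X$ be the complex with $\Omega M$ in degree $-1$, $P_{Q_1}\oplus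 P_1$ in degree $0$, and $\Omega Q_k\oplus(P_{Q_{k+1}}\oplus P_{k+1})$ in degree $k\ge 1$, with differentials $(c,d)\mapsto i_1q_1c+f_1d$ in degree $0$, $(w,(c,d))\mapsto(j_1w,\ i_2q_2c+f_2d)$ in degree $1$, and $(w,(c,d))\mapsto(0,(j_kw,\ i_{k+1}q_{k+1}c+f_{k+1}d))$ in degree $k\ge2$. Then the map $h:\Omega X\to P_X$ with $h_{-1}(w)=-w$, $h_0(c,d)=(-(i_1q_1c+f_1d),(c,d))$ and $$h_k(w,(c,d))=(-1)^k\bigl((-j_kw,\ -(i_{k+1}q_{k+1}c+f_{k+1}d)),(c,d)\bigr)\qquad(k\ge1)$$ is a kernel of $g$ in $C^b(\Lambda)$; that is, $\Omega X$ is the syzygy of $X$. 3. If $Q_m$ is not projective, then $\Omega X$ is isomorphic to a truncated projective resolution of $\Omega M$ of length $m$, whose projective in degree $i$ is isomorphic to $P_{Q_{i+1}}\oplus P_{i+1}$ for $0\le i<m$ and whose split-off summands are isomorphic to $\Omega Q_1,\dots,\Omega Q_m$. 4. If $Q_m$ is projective, then $\Omega X$ is isomorphic to a truncated projective resolution of $\Omega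 M$ of length $m-1$. For $m\ge2$ its projective in degree $i$ is isomorphic to $P_{Q_{i+1}}\oplus P_{i+1}$ for $0\le i<m-1$, and its split-off summands are isomorphic to $\Omega Q_1,\dots,\Omega Q_{m-2}$ and $\Omega Q_{m-1}\oplus Q_m$. For $m=1$ it is the one of length $0$, $\Omega M\xleftarrow{1}\Omega M$. 5. The complex $Q_1\xleftarrow{q_1}P_{Q_1}\xleftarrow{j_1}\Omega Q_1$ (with $Q_1$ in degree $-1$) is, up to isomorphism, a direct summand of $\Omega X$. 6. Let $1\le k\le m$. There is a minimal projective resolution of $Q_k$, truncated without split-off summands before the last term, $$Q_k\leftarrow P'_0\leftarrow P'_1\leftarrow\cdots\leftarrow P'_{k-1}\leftarrow\Omega^kQ_k$$ (with $Q_k$ in degree $-1$), which is a direct summand of every $k$-th syzygy $\Omega^kX$ of $X$ in $C^b(\Lambda)$. If the projective dimension of $Q_k$ is at least $k$, it is a truncated projective resolution of $Q_k$ of length $k$. -/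

import Mathlib

open CategoryTheory CategoryTheory.Limits

universe u v w

noncomputable section

/-! ### Projective covers and syzygies -/

/-- A projective cover of a module: a surjection from a projective module whose kernel is
superfluous (small). -/
structure IsModuleProjectiveCover {Λ : Type u} [Ring Λ] {P : Type v} {N : Type w}
    [AddCommGroup P] [Module Λ P] [AddCommGroup N] [Module Λ N] (p : P →ₗ[Λ] N) : Prop where
  projective : Module.Projective Λ P
  surjective : Function.Surjective p
  superfluous : ∀ U : Submodule Λ P, U ⊔ LinearMap.ker p = ⊤ → U = ⊤

/-- A projective cover in a category: an essential epimorphism from a projective object. -/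
structure IsProjectiveCover {C : Type u} [Category.{v} C] {P X : C} (p : P ⟶ X) : Prop where
  projective : Projective P
  epi : Epi p
  essential : ∀ {Y : C} (y : Y ⟶ P), Epi (y ≫ p) → Epi y

/-- `i : S ⟶ P` is a kernel of `p : P ⟶ X`. -/
def IsKernelOf {C : Type u} [Category.{v} C] [HasZeroMorphisms C] {S P X : C}
    (i : S ⟶ P) (p : P ⟶ X) : Prop :=
  ∃ h : i ≫ p = 0, Nonempty (IsLimit (KernelFork.ofι i h))

/-- `S` is a syzygy of `X`: a kernel of a projective cover of `X`. -/
def IsSyzygy {C : Type u} [Category.{v} C] [HasZeroMorphisms C] (S X : C) : Prop :=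
  ∃ (P : C) (p : P ⟶ X) (i : S ⟶ P), IsProjectiveCover p ∧ IsKernelOf i p

/-- `IsIteratedSyzygy k S X`: the object `S` is a `k`-th syzygy of `X`. -/
def IsIteratedSyzygy {C : Type u} [Category.{v} C] [HasZeroMorphisms C] : ℕ → C → C → Prop
  | 0, S, X => Nonempty (S ≅ X)
  | k + 1, S, X => ∃ S' : C, IsIteratedSyzygy k S' X ∧ IsSyzygy S S'

/-! ### Bounded complexes of finitely generated modules -/

section Bounded

variable (Λ : Type u) [Ring Λ] [IsArtinianRing Λ]

/-- Boundedness of a `ℤ`-graded chain complex of finitely generated `Λ`-modules. -/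
def isBoundedComplex : ObjectProperty (ChainComplex (FGModuleCat.{u} Λ) ℤ) :=
  fun X => ∃ a b : ℤ, ∀ i : ℤ, i < a ∨ b < i → IsZero (X.X i)

/-- The category `C^b(Λ)` of bounded chain complexes of finitely generated left `Λ`-modules;
its morphisms are the chain maps. -/
abbrev Cb := (isBoundedComplex Λ).FullSubcategory

end Bounded

/-- The relabelling `n ↦ n - 1` of degrees, which moves complexes that start in degree `0` to
complexes that start in degree `-1`. -/
def shiftEmbedding : (ComplexShape.down ℕ).Embedding (ComplexShape.down ℤ) :=
  ComplexShape.Embedding.mk' _ _ (fun n => (n : ℤ) - 1)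
    (fun _ _ h => by simpa using h)
    (by intro i j; simp only [ComplexShape.down_Rel]; omega)

section Build

variable {Λ : Type u} [Ring Λ] [IsArtinianRing Λ]

/-- The bounded complex `A 0 ← A 1 ← A 2 ← ⋯` with `A n` placed in degree `n - 1`
(so `A 0` is in degree `-1`), and zero in the degrees below `-1`. -/
def Cb.mk (A : ℕ → FGModuleCat.{u} Λ) (d : ∀ n, A (n + 1) ⟶ A n)
    (hd : ∀ n, d (n + 1) ≫ d n = 0) (b : ℕ) (hb : ∀ n, b ≤ n → Subsingleton (A n)) :
    Cb Λ where
  obj := (ChainComplex.of A d hd).extend shiftEmbedding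
  property := by
    refine ⟨-1, b, fun i hi => ?_⟩
    by_cases h : ∃ n : ℕ, (n : ℤ) - 1 = i
    · obtain ⟨n, rfl⟩ := h
      have hn : Subsingleton (A n) := hb n (by omega)
      refine IsZero.of_iso ?_ ((ChainComplex.of A d hd).extendXIso shiftEmbedding
        (i := n) rfl)
      rw [IsZero.iff_id_eq_zero]
      apply FGModuleCat.hom_ext
      ext x
      exact @Subsingleton.elim _ hn _ _
    · exact (ChainComplex.of A d hd).isZero_extend_X shiftEmbedding i
        (fun n hn => h ⟨n, hn⟩)

/-- The chain map given in degree `n - 1` by `φ n`. -/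
def Cb.homMk {A B : ℕ → FGModuleCat.{u} Λ} {d : ∀ n, A (n + 1) ⟶ A n}
    {d' : ∀ n, B (n + 1) ⟶ B n} {hd : ∀ n, d (n + 1) ≫ d n = 0}
    {hd' : ∀ n, d' (n + 1) ≫ d' n = 0} {b b' : ℕ}
    {hb : ∀ n, b ≤ n → Subsingleton (A n)} {hb' : ∀ n, b' ≤ n → Subsingleton (B n)}
    (φ : ∀ n, A n ⟶ B n) (comm : ∀ n, φ (n + 1) ≫ d' n = d n ≫ φ n) :
    Cb.mk A d hd b hb ⟶ Cb.mk B d' hd' b' hb' :=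
  ObjectProperty.homMk (HomologicalComplex.extendMap
    (ChainComplex.ofHom (X := ChainComplex.of A d hd) (Y := ChainComplex.of B d' hd') φ
      (fun n => by simpa using comm n)) shiftEmbedding)

/-- The complex `N ← N` in degrees `-1` and `0` with differential the identity, regarded as the
truncated projective resolution of `N` of length `0`. -/
def identityComplex (N : FGModuleCat.{u} Λ) : Cb Λ :=
  Cb.mk
    (fun n => match n with
      | 0 => N
      | 1 => N
      | _ + 2 => FGModuleCat.of Λ PUnit)
    (fun n => match n with
      | 0 => 𝟙 N
      | 1 => 0
      | _ + 2 => 0)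
    (fun n => match n with
      | 0 => zero_comp
      | 1 => zero_comp
      | _ + 2 => zero_comp)
    2
    (fun n hn => match n, hn with
      | _ + 2, _ => inferInstanceAs (Subsingleton PUnit))

end Build

/-! ### Truncated projective resolutions -/

section Truncated

set_option linter.unusedSectionVars false

variable {Λ : Type u} [Ring Λ]

/-- The data of an iterated choice of projective covers and direct sum decompositions of kernels,
stopped after `m` steps:
* `ε : P 0 → M` is a projective cover;
* `ker ε = Q_1 ⊕ R_1` and `P_1 = P 1` is a projective cover of `R_1`;
* `ker (P_i → R_i) = Q_{i+1} ⊕ R_{i+1}` and `P_{i+1} = P (i+1)` is a projective cover of `R_{i+1}`;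
* `P_i = 0` for `i ≥ m`, that is, `R_i = 0` for `i ≥ m`, and `Q_m = ker (P_{m-1} → R_{m-1})`.

Here `Q_{i+1} = Q i` is a submodule of `P_i = P i`, the map `f_{i+1} = f i` is the composite
`P_{i+1} → R_{i+1} ⊆ P_i`, and `R_{i+1}` is its range. -/
structure ResolutionData (M : FGModuleCat.{u} Λ) (m : ℕ) where
  P : ℕ → FGModuleCat.{u} Λ
  P_eq_zero : ∀ i, m ≤ i → Subsingleton (P i)
  ε : P 0 →ₗ[Λ] M
  f : ∀ i, P (i + 1) →ₗ[Λ] P i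
  Q : ∀ i, Submodule Λ (P i)
  ε_cover : IsModuleProjectiveCover ε
  f_cover : ∀ i, IsModuleProjectiveCover (f i).rangeRestrict
  disjoint : ∀ i, Disjoint (Q i) (LinearMap.range (f i))
  ker_ε : Q 0 ⊔ LinearMap.range (f 0) = LinearMap.ker ε
  ker_f : ∀ i, Q (i + 1) ⊔ LinearMap.range (f (i + 1)) = LinearMap.ker (f i)

namespace ResolutionData

variable {M : FGModuleCat.{u} Λ} {m : ℕ} (T : ResolutionData M m)

lemma ε_Q (x : T.Q 0) : T.ε x = 0 := by
  have : T.Q 0 ≤ LinearMap.ker T.ε := T.ker_ε ▸ le_sup_left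
  exact this x.2

lemma ε_f (x : T.P 1) : T.ε (T.f 0 x) = 0 := by
  have : LinearMap.range (T.f 0) ≤ LinearMap.ker T.ε := T.ker_ε ▸ le_sup_right
  exact this ⟨x, rfl⟩

lemma f_Q (i : ℕ) (x : T.Q (i + 1)) : T.f i x = 0 := by
  have : T.Q (i + 1) ≤ LinearMap.ker (T.f i) := T.ker_f i ▸ le_sup_left
  exact this x.2

lemma f_f (i : ℕ) (x : T.P (i + 2)) : T.f i (T.f (i + 1) x) = 0 := by
  have : LinearMap.range (T.f (i + 1)) ≤ LinearMap.ker (T.f i) := T.ker_f i ▸ le_sup_right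
  exact this ⟨x, rfl⟩

lemma Q_subsingleton (i : ℕ) (hi : m ≤ i) : Subsingleton (T.Q i) := by
  have := T.P_eq_zero i hi
  infer_instance

variable [IsArtinianRing Λ]

/-- The conditions on the data of a truncated (minimal) projective resolution of length `m`:
`m > 0`, the module `M` has projective dimension at least `m`, and `R_1, …, R_{m-1}` are
nonzero. -/
structure IsTruncatedResolution : Prop where
  pos : 0 < m
  le_pd : (m : WithBot ℕ∞) ≤ projectiveDimension M
  R_ne_zero : ∀ i, i + 1 < m → LinearMap.range (T.f i) ≠ ⊥

/-- The module `Ω M`, the kernel of the projective cover `P_0 → M`. -/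
abbrev syzygyModule : FGModuleCat.{u} Λ := FGModuleCat.of Λ (LinearMap.ker T.ε)

/-- The modules of `X`: `M` in degree `-1`, `P_0` in degree `0`, and `Q_k ⊕ P_k` in degree
`k ≥ 1`. -/
def X : ℕ → FGModuleCat.{u} Λ
  | 0 => M
  | 1 => T.P 0
  | k + 2 => FGModuleCat.of Λ (T.Q k × T.P (k + 1))

/-- The differential of `X`: it restricts to `f_k` on `P_k` and to the inclusion
`i_k : Q_k → P_{k-1}` on `Q_k`. -/
def d : ∀ n, T.X (n + 1) ⟶ T.X n
  | 0 => FGModuleCat.ofHom T.ε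
  | 1 => FGModuleCat.ofHom (LinearMap.coprod (T.Q 0).subtype (T.f 0))
  | k + 2 => FGModuleCat.ofHom
      (LinearMap.prod 0 (LinearMap.coprod (T.Q (k + 1)).subtype (T.f (k + 1))))

lemma d_comp_d (n : ℕ) : T.d (n + 1) ≫ T.d n = 0 := by
  match n with
  | 0 =>
    refine FGModuleCat.hom_ext (LinearMap.ext ?_)
    rintro ⟨x, y⟩
    change T.ε (x + T.f 0 y) = 0
    rw [map_add, T.ε_Q, T.ε_f, add_zero]
  | 1 =>
    refine FGModuleCat.hom_ext (LinearMap.ext ?_)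
    rintro ⟨x, y⟩
    change ((0 : T.Q 0) : T.P 0) + T.f 0 (x + T.f 1 y) = 0
    rw [map_add, T.f_Q, T.f_f, add_zero, ZeroMemClass.coe_zero, add_zero]
  | k + 2 =>
    refine FGModuleCat.hom_ext (LinearMap.ext ?_)
    rintro ⟨x, y⟩
    change ((0 : T.Q k), ((0 : T.Q (k + 1)) : T.P (k + 1)) + T.f (k + 1) (x + T.f (k + 2) y)) = 0
    rw [map_add, T.f_Q, T.f_f, add_zero, ZeroMemClass.coe_zero, add_zero]
    rfl

/-- The truncated projective resolution `X`, as an object of `C^b(Λ)`. -/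
def complex : Cb Λ :=
  Cb.mk T.X T.d T.d_comp_d (m + 2) (fun n hn => by
    obtain ⟨k, rfl⟩ : ∃ k, n = k + 2 := ⟨n - 2, by omega⟩
    have := T.P_eq_zero (k + 1) (by omega)
    have := T.Q_subsingleton k (by omega)
    exact inferInstanceAs (Subsingleton (T.Q k × T.P (k + 1))))

/-- A choice of a projective cover `q_k : P_{Q_k} → Q_k` of each split-off summand `Q_k`. As for
`Q`, the cover of `Q_{i+1}` has the index `i`. -/
structure SummandCovers where
  PQ : ℕ → FGModuleCat.{u} Λ
  q : ∀ i, PQ i →ₗ[Λ] T.Q i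
  q_cover : ∀ i, IsModuleProjectiveCover (q i)

namespace SummandCovers

variable {T} (C : T.SummandCovers)

lemma PQ_subsingleton (i : ℕ) (hi : m ≤ i) : Subsingleton (C.PQ i) := by
  have := T.Q_subsingleton i hi
  have h : (⊥ : Submodule Λ (C.PQ i)) = ⊤ := (C.q_cover i).superfluous ⊥ (by
    rw [bot_sup_eq, eq_top_iff]
    intro x _
    exact Subsingleton.elim _ _)
  exact (Submodule.subsingleton_iff Λ).mp (subsingleton_of_bot_eq_top h)

/-- The map `i_k ∘ q_k : P_{Q_k} → P_{k-1}`, with index `k - 1`. -/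
def iq (i : ℕ) : C.PQ i →ₗ[Λ] T.P i := (T.Q i).subtype ∘ₗ C.q i

lemma ε_iq (x : C.PQ 0) : T.ε (C.iq 0 x) = 0 := T.ε_Q _

lemma f_iq (i : ℕ) (x : C.PQ (i + 1)) : T.f i (C.iq (i + 1) x) = 0 := T.f_Q i _

lemma iq_ker (i : ℕ) (x : LinearMap.ker (C.q i)) : C.iq i x = 0 := by
  have h : C.q i x = 0 := x.2
  simp [iq, h]

/-- The map `(i_{k+1} ∘ q_{k+1}, f_{k+1}) : P_{Q_{k+1}} ⊕ P_{k+1} → P_k`. -/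
def iqf (k : ℕ) : (C.PQ k × T.P (k + 1)) →ₗ[Λ] T.P k := LinearMap.coprod (C.iq k) (T.f k)

lemma ε_iqf (x : C.PQ 0 × T.P 1) : T.ε (C.iqf 0 x) = 0 := by
  rw [iqf, LinearMap.coprod_apply, map_add, C.ε_iq, T.ε_f, add_zero]

lemma f_iqf (k : ℕ) (x : C.PQ (k + 1) × T.P (k + 2)) : T.f k (C.iqf (k + 1) x) = 0 := by
  rw [iqf, LinearMap.coprod_apply, map_add, C.f_iq, T.f_f, add_zero]

/-! #### The projective cover -/

/-- The modules of `P_X`: `P_0` in degree `-1`, `P_0 ⊕ (P_{Q_1} ⊕ P_1)` in degree `0`, and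
`(P_{Q_k} ⊕ P_k) ⊕ (P_{Q_{k+1}} ⊕ P_{k+1})` in degree `k ≥ 1`. -/
def coverX : ℕ → FGModuleCat.{u} Λ
  | 0 => T.P 0
  | 1 => FGModuleCat.of Λ (T.P 0 × (C.PQ 0 × T.P 1))
  | k + 2 => FGModuleCat.of Λ ((C.PQ k × T.P (k + 1)) × (C.PQ (k + 1) × T.P (k + 2)))

/-- The differential of `P_X`: the identity from the first half of each degree to the second half
of the degree below it. -/
def coverD : ∀ n, C.coverX (n + 1) ⟶ C.coverX n
  | 0 => FGModuleCat.ofHom (LinearMap.fst Λ (T.P 0) (C.PQ 0 × T.P 1))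
  | 1 => FGModuleCat.ofHom (LinearMap.prod 0
      (LinearMap.fst Λ (C.PQ 0 × T.P 1) (C.PQ 1 × T.P 2)))
  | k + 2 => FGModuleCat.ofHom (LinearMap.prod 0
      (LinearMap.fst Λ (C.PQ (k + 1) × T.P (k + 2)) (C.PQ (k + 2) × T.P (k + 3))))

lemma coverD_comp (n : ℕ) : C.coverD (n + 1) ≫ C.coverD n = 0 := by
  match n with
  | 0 => exact FGModuleCat.hom_ext (LinearMap.ext fun _ => rfl)
  | 1 => exact FGModuleCat.hom_ext (LinearMap.ext fun _ => rfl)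
  | k + 2 => exact FGModuleCat.hom_ext (LinearMap.ext fun _ => rfl)

/-- The complex `P_X`. -/
def cover : Cb Λ :=
  Cb.mk C.coverX C.coverD C.coverD_comp (m + 2) (fun n hn => by
    obtain ⟨k, rfl⟩ : ∃ k, n = k + 2 := ⟨n - 2, by omega⟩
    have := T.P_eq_zero (k + 1) (by omega)
    have := T.P_eq_zero (k + 2) (by omega)
    have := C.PQ_subsingleton k (by omega)
    have := C.PQ_subsingleton (k + 1) (by omega)
    exact inferInstanceAs
      (Subsingleton ((C.PQ k × T.P (k + 1)) × (C.PQ (k + 1) × T.P (k + 2)))))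

/-- The components of `g : P_X → X`, where `g n` is the component in degree `n - 1`:
* `g_{-1} = f_0`,
* `g_0 (a, (c, d)) = a + i_1 q_1 c + f_1 d`,
* `g_k ((a, b), (c, d)) = (q_k a, b + i_{k+1} q_{k+1} c + f_{k+1} d)` for `k ≥ 1`. -/
def g : ∀ n, C.coverX n ⟶ T.X n
  | 0 => FGModuleCat.ofHom T.ε
  | 1 => FGModuleCat.ofHom (LinearMap.coprod LinearMap.id (C.iqf 0))
  | k + 2 => FGModuleCat.ofHom (LinearMap.coprod
      (LinearMap.prodMap (C.q k) LinearMap.id)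
      (LinearMap.prod 0 (C.iqf (k + 1))))

lemma g_comm (n : ℕ) : C.g (n + 1) ≫ T.d n = C.coverD n ≫ C.g n := by
  match n with
  | 0 =>
    refine FGModuleCat.hom_ext (LinearMap.ext ?_)
    rintro ⟨a, x⟩
    change T.ε (a + C.iqf 0 x) = T.ε a
    rw [map_add, C.ε_iqf, add_zero]
  | 1 =>
    refine FGModuleCat.hom_ext (LinearMap.ext ?_)
    rintro ⟨⟨a, b⟩, x⟩
    change ((C.q 0 a + 0 : T.Q 0) : T.P 0) + T.f 0 (b + C.iqf 1 x)
      = 0 + (C.iq 0 a + T.f 0 b)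
    rw [map_add, C.f_iqf, add_zero, add_zero]
    exact (zero_add _).symm
  | k + 2 =>
    refine FGModuleCat.hom_ext (LinearMap.ext ?_)
    rintro ⟨⟨a, b⟩, x⟩
    change ((0 : T.Q k), ((C.q (k + 1) a + 0 : T.Q (k + 1)) : T.P (k + 1))
        + T.f (k + 1) (b + C.iqf (k + 2) x))
      = (C.q k 0 + 0, 0 + (C.iq (k + 1) a + T.f (k + 1) b))
    rw [map_add, C.f_iqf, add_zero, add_zero, add_zero, zero_add, map_zero]
    rfl

/-- The chain map `g : P_X → X`. -/
def coverMap : C.cover ⟶ T.complex := Cb.homMk C.g C.g_comm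

/-! #### The syzygy -/

/-- The modules of `Ω X`: `Ω M` in degree `-1`, `P_{Q_1} ⊕ P_1` in degree `0`, and
`Ω Q_k ⊕ (P_{Q_{k+1}} ⊕ P_{k+1})` in degree `k ≥ 1`. -/
def syzygyX : ℕ → FGModuleCat.{u} Λ
  | 0 => T.syzygyModule
  | 1 => FGModuleCat.of Λ (C.PQ 0 × T.P 1)
  | k + 2 => FGModuleCat.of Λ (LinearMap.ker (C.q k) × (C.PQ (k + 1) × T.P (k + 2)))

/-- The differential of `Ω X`: it restricts to the inclusion `j_k : Ω Q_k → P_{Q_k}`, to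
`i_k ∘ q_k : P_{Q_k} → P_{k-1}` and to `f_k : P_k → P_{k-1}`; in degree `0` the last two have their
images in `Ω M ⊆ P_0`. -/
def syzygyD : ∀ n, C.syzygyX (n + 1) ⟶ C.syzygyX n
  | 0 => FGModuleCat.ofHom (LinearMap.codRestrict (LinearMap.ker T.ε) (C.iqf 0) C.ε_iqf)
  | 1 => FGModuleCat.ofHom (LinearMap.prodMap (LinearMap.ker (C.q 0)).subtype (C.iqf 1))
  | k + 2 => FGModuleCat.ofHom (LinearMap.prod 0
      (LinearMap.prodMap (LinearMap.ker (C.q (k + 1))).subtype (C.iqf (k + 2))))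

lemma syzygyD_comp (n : ℕ) : C.syzygyD (n + 1) ≫ C.syzygyD n = 0 := by
  match n with
  | 0 =>
    refine FGModuleCat.hom_ext (LinearMap.ext ?_)
    rintro ⟨w, x⟩
    refine Subtype.ext ?_
    change C.iq 0 w + T.f 0 (C.iqf 1 x) = 0
    rw [C.iq_ker, C.f_iqf, add_zero]
  | 1 =>
    refine FGModuleCat.hom_ext (LinearMap.ext ?_)
    rintro ⟨w, x⟩
    change (((0 : LinearMap.ker (C.q 0)) : C.PQ 0), C.iq 1 w + T.f 1 (C.iqf 2 x)) = 0
    rw [C.iq_ker, C.f_iqf, add_zero]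
    rfl
  | k + 2 =>
    refine FGModuleCat.hom_ext (LinearMap.ext ?_)
    rintro ⟨w, x⟩
    change ((0 : LinearMap.ker (C.q k)), (((0 : LinearMap.ker (C.q (k + 1))) : C.PQ (k + 1)),
      C.iq (k + 2) w + T.f (k + 2) (C.iqf (k + 3) x))) = 0
    rw [C.iq_ker, C.f_iqf, add_zero]
    rfl

/-- The complex `Ω X`. -/
def syzygy : Cb Λ :=
  Cb.mk C.syzygyX C.syzygyD C.syzygyD_comp (m + 2) (fun n hn => by
    obtain ⟨k, rfl⟩ : ∃ k, n = k + 2 := ⟨n - 2, by omega⟩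
    have := T.P_eq_zero (k + 2) (by omega)
    have := C.PQ_subsingleton k (by omega)
    have := C.PQ_subsingleton (k + 1) (by omega)
    exact inferInstanceAs
      (Subsingleton (LinearMap.ker (C.q k) × (C.PQ (k + 1) × T.P (k + 2)))))

/-- The components of `h : Ω X → P_X`, where `h n` is the component in degree `n - 1`:
* `h_{-1} w = -w`,
* `h_0 (c, d) = (-(i_1 q_1 c + f_1 d), (c, d))`,
* `h_k (w, (c, d)) = (-1)^k ((-w, -(i_{k+1} q_{k+1} c + f_{k+1} d)), (c, d))` for `k ≥ 1`. -/
def h : ∀ n, C.syzygyX n ⟶ C.coverX n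
  | 0 => FGModuleCat.ofHom (-(LinearMap.ker T.ε).subtype)
  | 1 => FGModuleCat.ofHom (LinearMap.prod (-(C.iqf 0)) LinearMap.id)
  | k + 2 => FGModuleCat.ofHom ((-1 : ℤ) ^ (k + 1) •
      LinearMap.prod
        (-(LinearMap.prodMap (LinearMap.ker (C.q k)).subtype (C.iqf (k + 1))))
        (LinearMap.snd Λ (LinearMap.ker (C.q k)) (C.PQ (k + 1) × T.P (k + 2))))

lemma h_comm (n : ℕ) : C.h (n + 1) ≫ C.coverD n = C.syzygyD n ≫ C.h n := by
  match n with
  | 0 =>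
    refine FGModuleCat.hom_ext (LinearMap.ext ?_)
    intro x
    rfl
  | 1 =>
    refine FGModuleCat.hom_ext (LinearMap.ext ?_)
    rintro ⟨w, x⟩
    change ((0 : T.P 0), ((-1 : ℤ) ^ 1) • (-((w : C.PQ 0), C.iqf 1 x)))
      = (-(C.iq 0 w + T.f 0 (C.iqf 1 x)), ((w : C.PQ 0), C.iqf 1 x))
    rw [C.iq_ker, C.f_iqf, add_zero, neg_zero, pow_one, neg_smul, one_smul, neg_neg]
  | k + 2 =>
    refine FGModuleCat.hom_ext (LinearMap.ext ?_)
    rintro ⟨w, x⟩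
    change ((0 : C.PQ k × T.P (k + 1)), ((-1 : ℤ) ^ (k + 2)) •
        (-((w : C.PQ (k + 1)), C.iqf (k + 2) x)))
      = ((-1 : ℤ) ^ (k + 1)) • (-(((0 : LinearMap.ker (C.q k)) : C.PQ k),
          C.iq (k + 1) w + T.f (k + 1) (C.iqf (k + 2) x)),
          ((w : C.PQ (k + 1)), C.iqf (k + 2) x))
    rw [C.iq_ker, C.f_iqf, add_zero, pow_succ (-1 : ℤ) (k + 1), mul_neg_one, neg_smul, smul_neg,
      neg_neg, ZeroMemClass.coe_zero, Prod.mk_zero_zero, neg_zero]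
    exact Prod.ext (smul_zero ((-1 : ℤ) ^ (k + 1))).symm rfl

/-- The chain map `h : Ω X → P_X`. -/
def syzygyMap : C.syzygy ⟶ C.cover := Cb.homMk C.h C.h_comm

end SummandCovers

end ResolutionData

end Truncated

end

noncomputable section

/-! ### Uniqueness of projective covers and syzygies -/

section Uniqueness

variable {C : Type u} [Category.{v} C]

/-! The complex P_X is a sum of complexes P ← P with identity differential. It is therefore a
contractible complex of projectives, and such complexes are projective in C^b(Λ)
(`Cb.projective_mk`). Essentiality of g concerns graded submodules I closed under the differential
with I + ker g = P_X. Superfluousness of the kernels of the chosen covers shows that I projects onto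
the first half of each degree, and the second half then comes from the degree above by the
differential (`eq_top_of_sup_ker_g`). The kernel of g is computed degree by degree (`range_h`).

Since Q_k and R_k intersect trivially, the cover P_{Q_k} ⊕ P_k of Q_k ⊕ R_k has kernel ΩQ_k ⊕ ker
f_k (`ker_iqf`), and the next pair P_{Q_{k+1}} ⊕ P_{k+1} covers ker f_k. So ΩX is the complex of
resolution data for ΩM whose summands are the ΩQ_k (`syzygyData`). If Q_m is not projective,
dimension shifting gives the remaining conditions. If Q_m is projective, then ΩQ_m = 0 and the last
projective is Q_m itself. For m ≥ 2 it embeds in the projective before it, and counting its image as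
split off shortens the resolution by one (`shorten`); for m = 1 it is ΩM.

For iterated syzygies, uniqueness allows the explicit ones to be used at every stage. After one
syzygy, the cover of Q_k sits as a retract at index k - 1 (a `Marking`). Each further syzygy moves
it down by one index and lengthens the resolution of Q_k by one step (`Marking.nonempty_syzygy`). At
index 0 the retraction extends to degree -1 and becomes a retraction of complexes
(`Marking.nonempty_retract`). -/

lemma IsProjectiveCover.isIso_of_comp_eq {P P' X : C} {p : P ⟶ X} {p' : P' ⟶ X}
    (hp : IsProjectiveCover p) (hp' : IsProjectiveCover p') (f : P ⟶ P') (hf : f ≫ p' = p) :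
    IsIso f := by
  have := hp.epi
  have := hp.projective
  have := hp'.projective
  have : Epi f := hp'.essential f (hf ▸ hp.epi)
  let s : P' ⟶ P := Projective.factorThru (𝟙 P') f
  have hs : s ≫ f = 𝟙 P' := Projective.factorThru_comp _ _
  -- The section `s` is itself a map of covers, so essentiality of `p` makes it epi; a split mono
  -- that is epi is invertible.
  have hsp : s ≫ p = p' := by rw [← hf, ← Category.assoc, hs, Category.id_comp]
  have : Epi s := hp.essential s (hsp ▸ hp'.epi)
  have hfs : f ≫ s = 𝟙 P := by
    rw [← cancel_epi s, ← Category.assoc, hs, Category.id_comp, Category.comp_id]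
  exact ⟨s, hfs, hs⟩

/-- A lift between the two covers is invertible, so it and its inverse induce mutually inverse maps
of kernels. This permits replacing an arbitrary syzygy by the explicit one. -/
lemma nonempty_iso_of_isProjectiveCover [HasZeroMorphisms C] {S S' P P' X X' : C}
    {p : P ⟶ X} {p' : P' ⟶ X'} {i : S ⟶ P} {i' : S' ⟶ P'}
    (hp : IsProjectiveCover p) (hi : IsKernelOf i p)
    (hp' : IsProjectiveCover p') (hi' : IsKernelOf i' p') (e : X ≅ X') :
    Nonempty (S ≅ S') := by
  have hpe : IsProjectiveCover (p ≫ e.hom) := by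
    have := hp.epi
    refine ⟨hp.projective, inferInstance, fun y hy => hp.essential y ?_⟩
    have h : y ≫ p = (y ≫ p ≫ e.hom) ≫ e.inv := by simp
    rw [h]
    infer_instance
  have := hp'.epi
  have := hp.projective
  let f : P ⟶ P' := Projective.factorThru (p ≫ e.hom) p'
  have hf : f ≫ p' = p ≫ e.hom := Projective.factorThru_comp _ _
  have : IsIso f := hpe.isIso_of_comp_eq hp' f hf
  obtain ⟨h0, ⟨hl⟩⟩ := hi
  obtain ⟨h0', ⟨hl'⟩⟩ := hi'
  have hfi : inv f ≫ p = p' ≫ e.inv := by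
    rw [IsIso.inv_comp_eq, ← Category.assoc, hf]
    simp
  obtain ⟨a, ha⟩ := KernelFork.IsLimit.lift' hl' (i ≫ f) (by
    rw [Category.assoc, hf, reassoc_of% h0, zero_comp])
  obtain ⟨b, hb⟩ := KernelFork.IsLimit.lift' hl (i' ≫ inv f) (by
    rw [Category.assoc, hfi, reassoc_of% h0', zero_comp])
  simp only [Fork.ι_ofι] at ha hb
  have : Mono i := ⟨fun x y hxy => Fork.IsLimit.hom_ext hl (by simpa using hxy)⟩
  have : Mono i' := ⟨fun x y hxy => Fork.IsLimit.hom_ext hl' (by simpa using hxy)⟩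
  refine ⟨⟨a, b, ?_, ?_⟩⟩
  · rw [← cancel_mono i, Category.assoc, hb, ← Category.assoc, ha]
    simp
  · rw [← cancel_mono i', Category.assoc, ha, ← Category.assoc, hb]
    simp

end Uniqueness

/-! ### Superfluous submodules and projective covers of modules -/

section Modules

variable {Λ : Type u} [Ring Λ]

/-- A submodule is superfluous (small) if no proper submodule is a supplement of it. -/
def IsSuperfluous {A : Type v} [AddCommGroup A] [Module Λ A] (N : Submodule Λ A) : Prop :=
  ∀ U : Submodule Λ A, U ⊔ N = ⊤ → U = ⊤

variable {A : Type v} {B : Type w} [AddCommGroup A] [Module Λ A] [AddCommGroup B] [Module Λ B]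

lemma IsSuperfluous.mono {N N' : Submodule Λ A} (h : IsSuperfluous N) (hN : N' ≤ N) :
    IsSuperfluous N' :=
  fun U hU => h U (top_le_iff.mp (hU ▸ sup_le_sup_left hN U))

lemma IsSuperfluous.sup {N N' : Submodule Λ A} (h : IsSuperfluous N) (h' : IsSuperfluous N') :
    IsSuperfluous (N ⊔ N') :=
  fun U hU => h U (h' (U ⊔ N) (by rw [sup_assoc, hU]))

/-- The preimage of a supplement of the image of `N` supplements `N`, hence is everything; so the
supplement already contains the range of `f`. -/
lemma IsSuperfluous.map {N : Submodule Λ A} (h : IsSuperfluous N) (f : A →ₗ[Λ] B) :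
    IsSuperfluous (N.map f) := by
  intro U hU
  have h1 : U.comap f = ⊤ := by
    refine h _ (eq_top_iff.mpr fun x _ => ?_)
    have hx : f x ∈ U ⊔ N.map f := hU ▸ Submodule.mem_top
    obtain ⟨y, hy, _, ⟨z, hz, rfl⟩, hyz⟩ := Submodule.mem_sup.mp hx
    refine Submodule.mem_sup.mpr ⟨x - z, ?_, z, hz, by abel⟩
    rw [Submodule.mem_comap, map_sub, ← hyz, add_sub_cancel_right]
    exact hy
  rw [← hU, left_eq_sup]
  exact (Submodule.map_mono le_top).trans (Submodule.map_le_iff_le_comap.mpr h1.ge)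

lemma IsSuperfluous.prod {N : Submodule Λ A} {N' : Submodule Λ B} (h : IsSuperfluous N)
    (h' : IsSuperfluous N') : IsSuperfluous (N.prod N') := by
  refine ((h.map (LinearMap.inl Λ A B)).sup (h'.map (LinearMap.inr Λ A B))).mono ?_
  rintro ⟨x, y⟩ ⟨hx, hy⟩
  exact Submodule.mem_sup.mpr ⟨_, ⟨x, hx, rfl⟩, _, ⟨y, hy, rfl⟩, by simp⟩

lemma IsModuleProjectiveCover.isSuperfluous_ker {p : A →ₗ[Λ] B} (h : IsModuleProjectiveCover p) :
    IsSuperfluous (LinearMap.ker p) := h.superfluous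

lemma IsModuleProjectiveCover.isSuperfluous_ker_of_rangeRestrict {f : A →ₗ[Λ] B}
    (h : IsModuleProjectiveCover f.rangeRestrict) : IsSuperfluous (LinearMap.ker f) := by
  simpa using h.isSuperfluous_ker

lemma isModuleProjectiveCover_rangeRestrict [Module.Projective Λ A] {f : A →ₗ[Λ] B}
    (h : IsSuperfluous (LinearMap.ker f)) : IsModuleProjectiveCover f.rangeRestrict :=
  ⟨inferInstance, f.surjective_rangeRestrict, by rw [LinearMap.ker_rangeRestrict]; exact h⟩

lemma exists_comp_eq_of_ker_le {D : Type*} [AddCommGroup D] [Module Λ D] {p : A →ₗ[Λ] B}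
    (hp : Function.Surjective p) (g : A →ₗ[Λ] D) (h : LinearMap.ker p ≤ LinearMap.ker g) :
    ∃ k : B →ₗ[Λ] D, k ∘ₗ p = g := by
  refine ⟨(LinearMap.ker p).liftQ g h ∘ₗ (p.quotKerEquivOfSurjective hp).symm.toLinearMap, ?_⟩
  ext x
  have : (p.quotKerEquivOfSurjective hp).symm (p x) = (LinearMap.ker p).mkQ x := by
    rw [LinearEquiv.symm_apply_eq]; rfl
  simp [this]

/-- Each `x - f x` lies in `ker p`, so the range of `f` supplements a superfluous submodule; a
surjective endomorphism of a Noetherian module is injective. -/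
lemma IsModuleProjectiveCover.bijective_of_comp_eq {A : Type v} {B : Type w} [AddCommGroup A]
    [Module Λ A] [AddCommGroup B] [Module Λ B] [IsNoetherian Λ A]
    {p : A →ₗ[Λ] B} (hp : IsModuleProjectiveCover p) (f : A →ₗ[Λ] A) (hf : p ∘ₗ f = p) :
    Function.Bijective f := by
  have hs : Function.Surjective f := by
    rw [← LinearMap.range_eq_top]
    refine hp.superfluous _ (eq_top_iff.mpr fun x _ => ?_)
    refine Submodule.mem_sup.mpr ⟨f x, ⟨x, rfl⟩, x - f x, ?_, by abel⟩
    rw [LinearMap.mem_ker, map_sub, ← LinearMap.comp_apply, hf, sub_self]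
  exact ⟨IsNoetherian.injective_of_surjective_endomorphism f hs, hs⟩

/-- Lifts of `i` and `r` compose only to an automorphism over `B`. Correcting the lift of `r` by its
inverse makes the retraction strict and keeps the square with the covers, because the inverse also
lies over `B`. -/
lemma IsModuleProjectiveCover.exists_retract {A : Type v} {B : Type w} [AddCommGroup A]
    [Module Λ A] [AddCommGroup B] [Module Λ B] {A' : Type*} {B' : Type*} [AddCommGroup A']
    [Module Λ A'] [AddCommGroup B'] [Module Λ B'] [IsNoetherian Λ A]
    {p : A →ₗ[Λ] B} {p' : A' →ₗ[Λ] B'} (hp : IsModuleProjectiveCover p)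
    (hp' : IsModuleProjectiveCover p') (i : B →ₗ[Λ] B') (r : B' →ₗ[Λ] B)
    (h : r ∘ₗ i = LinearMap.id) :
    ∃ (a : A →ₗ[Λ] A') (b : A' →ₗ[Λ] A), b ∘ₗ a = LinearMap.id ∧ p' ∘ₗ a = i ∘ₗ p ∧
      p ∘ₗ b = r ∘ₗ p' := by
  have := hp.projective
  have := hp'.projective
  obtain ⟨a, ha⟩ := Module.projective_lifting_property p' (i ∘ₗ p) hp'.surjective
  obtain ⟨b, hb⟩ := Module.projective_lifting_property p (r ∘ₗ p') hp.surjective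
  have hba : p ∘ₗ (b ∘ₗ a) = p := by
    rw [← LinearMap.comp_assoc, hb, LinearMap.comp_assoc, ha, ← LinearMap.comp_assoc, h,
      LinearMap.id_comp]
  let e := LinearEquiv.ofBijective (b ∘ₗ a) (hp.bijective_of_comp_eq _ hba)
  have he : p ∘ₗ e.symm.toLinearMap = p := by
    ext x
    obtain ⟨y, rfl⟩ := e.surjective x
    rw [LinearMap.comp_apply, LinearEquiv.coe_coe, e.symm_apply_apply]
    exact (LinearMap.congr_fun hba y).symm
  refine ⟨a, e.symm.toLinearMap ∘ₗ b, ?_, ha, ?_⟩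
  · ext x
    exact e.symm_apply_apply x
  · rw [← LinearMap.comp_assoc, he, hb]

/-- Over a left Artinian ring every finitely generated module has a projective cover. -/
lemma exists_isModuleProjectiveCover [IsArtinianRing Λ] (N : FGModuleCat.{u} Λ) :
    ∃ (P : FGModuleCat.{u} Λ) (p : P →ₗ[Λ] N), IsModuleProjectiveCover p := by
  obtain ⟨n, π, hπ⟩ := Module.Finite.exists_fin' Λ N
  let K := LinearMap.ker π
  -- A minimal supplement `U` of the kernel exists by the descending chain condition; minimality
  -- makes the kernel of `π` on `U` superfluous.
  obtain ⟨U, hU, hmin⟩ := IsWellFounded.wf.has_min (r := (· < ·))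
    {U : Submodule Λ (Fin n → Λ) | U ⊔ K = ⊤} ⟨⊤, top_sup_eq _⟩
  have hUmin : ∀ V : Submodule Λ (Fin n → Λ), V ≤ U → V ⊔ K = ⊤ → V = U := fun V hV hVK =>
    hV.eq_of_not_lt (hmin V hVK)
  have hsurj : Function.Surjective (π ∘ₗ U.subtype) := by
    intro y
    obtain ⟨x, rfl⟩ := hπ y
    have hx : x ∈ U ⊔ K := hU ▸ Submodule.mem_top
    obtain ⟨a, ha, b, hb, rfl⟩ := Submodule.mem_sup.mp hx
    have hb : π b = 0 := hb
    exact ⟨⟨a, ha⟩, by simp [hb]⟩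
  have hsup : ∀ V : Submodule Λ U, V ⊔ LinearMap.ker (π ∘ₗ U.subtype) = ⊤ → V = ⊤ := by
    intro V hV
    have h1 : V.map U.subtype = U := by
      refine hUmin _ (Submodule.map_subtype_le U V) (top_le_iff.mp (hU ▸ sup_le ?_ le_sup_right))
      intro x hx
      have hx' : (⟨x, hx⟩ : U) ∈ V ⊔ LinearMap.ker (π ∘ₗ U.subtype) := hV ▸ Submodule.mem_top
      obtain ⟨a, ha, b, hb, hab⟩ := Submodule.mem_sup.mp hx'
      exact Submodule.mem_sup.mpr ⟨a, ⟨a, ha, rfl⟩, b, hb, congrArg Subtype.val hab⟩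
    refine eq_top_iff.mpr fun x _ => ?_
    obtain ⟨y, hy, hyx⟩ : (x : Fin n → Λ) ∈ V.map U.subtype := h1.symm ▸ x.2
    exact (Subtype.ext hyx : y = x) ▸ hy
  -- Projectivity of `U`: lifting `π` through its restriction to `U` gives an endomorphism of `U`
  -- over `N`. It is bijective, so `U` is a direct summand of the free module.
  obtain ⟨φ, hφ⟩ := Module.projective_lifting_property (π ∘ₗ U.subtype) π hsurj
  have hφU : (π ∘ₗ U.subtype) ∘ₗ (φ ∘ₗ U.subtype) = π ∘ₗ U.subtype := by
    rw [← LinearMap.comp_assoc, hφ]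
  have hs : Function.Surjective (φ ∘ₗ U.subtype) := by
    rw [← LinearMap.range_eq_top]
    refine hsup _ (eq_top_iff.mpr fun x _ => ?_)
    refine Submodule.mem_sup.mpr ⟨φ x, ⟨x, rfl⟩, x - φ x, ?_, by abel⟩
    rw [LinearMap.mem_ker, map_sub, sub_eq_zero]
    exact (LinearMap.congr_fun hφU x).symm
  have hb : Function.Bijective (φ ∘ₗ U.subtype) :=
    ⟨IsNoetherian.injective_of_surjective_endomorphism _ hs, hs⟩
  let e := LinearEquiv.ofBijective _ hb
  refine ⟨FGModuleCat.of Λ U, π ∘ₗ U.subtype, ?_, hsurj, hsup⟩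
  refine Module.Projective.of_split U.subtype (e.symm.toLinearMap ∘ₗ φ) ?_
  ext x : 1
  exact e.symm_apply_apply x

/-- Over a left Artinian ring the split-off summands have projective covers. -/
lemma ResolutionData.nonempty_summandCovers [IsArtinianRing Λ] {M : FGModuleCat.{u} Λ} {m : ℕ}
    (T : ResolutionData M m) : Nonempty T.SummandCovers := by
  choose P p hp using fun i => exists_isModuleProjectiveCover (FGModuleCat.of Λ (T.Q i))
  exact ⟨⟨P, p, hp⟩⟩

end Modules

/-! ### Finitely generated modules -/

section FG

variable {Λ : Type u} [Ring Λ]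

lemma FGModuleCat.epi_of_surjective {A B : FGModuleCat.{u} Λ} (f : A ⟶ B)
    (hf : Function.Surjective f.hom.hom) : Epi f := by
  refine ⟨fun g h hgh => FGModuleCat.hom_ext (LinearMap.ext fun y => ?_)⟩
  obtain ⟨x, rfl⟩ := hf y
  exact LinearMap.congr_fun (congrArg (fun k => k.hom.hom) hgh) x

lemma FGModuleCat.surjective_of_epi {A B : FGModuleCat.{u} Λ} (f : A ⟶ B) [Epi f] :
    Function.Surjective f.hom.hom := by
  let R : Submodule Λ B := LinearMap.range f.hom.hom
  let c : B ⟶ FGModuleCat.of Λ (B ⧸ R) := FGModuleCat.ofHom R.mkQ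
  have hc : c = 0 := by
    rw [← cancel_epi f, comp_zero]
    exact FGModuleCat.hom_ext (LinearMap.ext fun x =>
      (Submodule.Quotient.mk_eq_zero R).mpr ⟨x, rfl⟩)
  intro y
  have hy : R.mkQ y = 0 := LinearMap.congr_fun (congrArg (fun k => k.hom.hom) hc) y
  exact (Submodule.Quotient.mk_eq_zero R).mp hy

end FG

/-! ### Morphisms of bounded complexes -/

section Morphisms

set_option linter.unusedSectionVars false

variable {Λ : Type u} [Ring Λ] [IsArtinianRing Λ]

lemma Cb.hom_ext {X Y : Cb Λ} {f g : X ⟶ Y}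
    (h : ∀ (i : ℤ) (x : X.obj.X i), (f.hom.f i).hom.hom x = (g.hom.f i).hom.hom x) : f = g :=
  ObjectProperty.hom_ext _ (HomologicalComplex.hom_ext _ _ fun i =>
    FGModuleCat.hom_ext (LinearMap.ext (h i)))

lemma Cb.d_comm {X Y : Cb Λ} (f : X ⟶ Y) (i j : ℤ) (x : X.obj.X i) :
    (Y.obj.d i j).hom.hom ((f.hom.f i).hom.hom x) = (f.hom.f j).hom.hom ((X.obj.d i j).hom.hom x) :=
  LinearMap.congr_fun (congrArg (fun k => k.hom.hom) (f.hom.comm i j)) x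

lemma Cb.epi_of_surjective {X Y : Cb Λ} (f : X ⟶ Y)
    (hf : ∀ i, Function.Surjective (f.hom.f i).hom.hom) : Epi f := by
  refine ⟨fun g h hgh => Cb.hom_ext fun i y => ?_⟩
  obtain ⟨x, rfl⟩ := hf i y
  exact LinearMap.congr_fun (congrArg (fun k => (k.hom.f i).hom.hom) hgh) x

/-- The cokernel formed among all complexes is again bounded, so an epimorphism of C^b(Λ) remains
one among all complexes, where epimorphisms are tested degreewise. -/
lemma Cb.surjective_of_epi {X Y : Cb Λ} (f : X ⟶ Y) [Epi f] (i : ℤ) :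
    Function.Surjective (f.hom.f i).hom.hom := by
  have hb : isBoundedComplex Λ (cokernel f.hom) := by
    obtain ⟨a, b, hab⟩ := Y.property
    refine ⟨a, b, fun j hj => ?_⟩
    have h0 := hab j hj
    rw [IsZero.iff_id_eq_zero, ← cancel_epi ((cokernel.π f.hom).f j)]
    exact h0.eq_of_src _ _
  let c : Y ⟶ (⟨cokernel f.hom, hb⟩ : Cb Λ) := ObjectProperty.homMk (cokernel.π f.hom)
  have hc : c = 0 := by
    rw [← cancel_epi f, comp_zero]
    exact ObjectProperty.hom_ext _ (cokernel.condition f.hom)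
  have hc' : cokernel.π f.hom = 0 := congrArg (fun k => k.hom) hc
  have : Epi f.hom := Preadditive.epi_of_cokernel_zero hc'
  exact FGModuleCat.surjective_of_epi (f.hom.f i)

/-- A degreewise injective map which is degreewise the kernel of another one is its kernel. -/
lemma Cb.isKernelOf {S P X : Cb Λ} (i : S ⟶ P) (p : P ⟶ X)
    (hi : ∀ n, Function.Injective (i.hom.f n).hom.hom)
    (hip : ∀ n, LinearMap.range (i.hom.f n).hom.hom = LinearMap.ker (p.hom.f n).hom.hom) :
    IsKernelOf i p := by
  have h0 : i ≫ p = 0 := Cb.hom_ext fun n x => by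
    have : (i.hom.f n).hom.hom x ∈ LinearMap.ker (p.hom.f n).hom.hom := hip n ▸ ⟨x, rfl⟩
    exact this
  have : Mono i := ⟨fun a b hab => Cb.hom_ext fun n x => hi n
    (LinearMap.congr_fun (congrArg (fun k => (k.hom.f n).hom.hom) hab) x)⟩
  have hl : ∀ {W : Cb Λ} (k : W ⟶ P), k ≫ p = 0 → ∃ l : W ⟶ S, l ≫ i = k := by
    intro W k hk
    have hmem : ∀ n (x : W.obj.X n), (k.hom.f n).hom.hom x ∈
        LinearMap.range (i.hom.f n).hom.hom := fun n x => by
      rw [hip n]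
      exact LinearMap.congr_fun (congrArg (fun k => (k.hom.f n).hom.hom) hk) x
    let e : ∀ n, S.obj.X n ≃ₗ[Λ] LinearMap.range (i.hom.f n).hom.hom := fun n =>
      LinearEquiv.ofInjective _ (hi n)
    let l : ∀ n, W.obj.X n →ₗ[Λ] S.obj.X n := fun n =>
      (e n).symm.toLinearMap ∘ₗ (k.hom.f n).hom.hom.codRestrict _ (hmem n)
    have hle : ∀ n x, (i.hom.f n).hom.hom (l n x) = (k.hom.f n).hom.hom x := fun n x =>
      congrArg Subtype.val ((e n).apply_symm_apply ⟨_, hmem n x⟩)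
    refine ⟨ObjectProperty.homMk ⟨fun n => FGModuleCat.ofHom (l n), fun a b _ =>
      FGModuleCat.hom_ext (LinearMap.ext fun x => hi b ?_)⟩, Cb.hom_ext hle⟩
    change (i.hom.f b).hom.hom ((S.obj.d a b).hom.hom (l a x)) =
      (i.hom.f b).hom.hom (l b ((W.obj.d a b).hom.hom x))
    rw [← Cb.d_comm, hle, hle, Cb.d_comm]
  exact ⟨h0, ⟨KernelFork.IsLimit.ofι i h0 (fun k hk => (hl k hk).choose)
    (fun k hk => (hl k hk).choose_spec)
    (fun k hk b hb => by rw [← cancel_mono i, hb, (hl k hk).choose_spec])⟩⟩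

end Morphisms

/-! ### The complexes `Cb.mk` -/

namespace Cb

set_option linter.unusedSectionVars false

variable {Λ : Type u} [Ring Λ] [IsArtinianRing Λ]
  {A : ℕ → FGModuleCat.{u} Λ} {d : ∀ n, A (n + 1) ⟶ A n} {hd : ∀ n, d (n + 1) ≫ d n = 0} {b : ℕ}
  {hb : ∀ n, b ≤ n → Subsingleton (A n)}
  {A' : ℕ → FGModuleCat.{u} Λ} {d' : ∀ n, A' (n + 1) ⟶ A' n} {hd' : ∀ n, d' (n + 1) ≫ d' n = 0}
  {b' : ℕ} {hb' : ∀ n, b' ≤ n → Subsingleton (A' n)}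
  {A'' : ℕ → FGModuleCat.{u} Λ} {d'' : ∀ n, A'' (n + 1) ⟶ A'' n}
  {hd'' : ∀ n, d'' (n + 1) ≫ d'' n = 0} {b'' : ℕ} {hb'' : ∀ n, b'' ≤ n → Subsingleton (A'' n)}

/-- The module of `Cb.mk A` in degree `n - 1`. -/
def mkIso (n : ℕ) {i : ℤ} (h : (n : ℤ) - 1 = i) : (Cb.mk A d hd b hb).obj.X i ≅ A n :=
  (ChainComplex.of A d hd).extendXIso shiftEmbedding h

lemma mk_isZero {i : ℤ} (h : ∀ n : ℕ, (n : ℤ) - 1 ≠ i) : IsZero ((Cb.mk A d hd b hb).obj.X i) :=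
  (ChainComplex.of A d hd).isZero_extend_X shiftEmbedding i h

lemma mk_d {n : ℕ} {i j : ℤ} (hi : ((n + 1 : ℕ) : ℤ) - 1 = i) (hj : (n : ℤ) - 1 = j) :
    (Cb.mk A d hd b hb).obj.d i j = (mkIso (n + 1) hi).hom ≫ d n ≫ (mkIso n hj).inv := by
  have := (ChainComplex.of A d hd).extend_d_eq shiftEmbedding (i := n + 1) (j := n) hi hj
  rw [show (ChainComplex.of A d hd).d (n + 1) n = d n from ChainComplex.of_d A d n] at this
  exact this

lemma homMk_f (φ : ∀ n, A n ⟶ A' n) (comm : ∀ n, φ (n + 1) ≫ d' n = d n ≫ φ n) {n : ℕ} {i : ℤ}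
    (hi : (n : ℤ) - 1 = i) :
    (Cb.homMk (hd := hd) (hd' := hd') (hb := hb) (hb' := hb') φ comm).hom.f i =
      (mkIso n hi).hom ≫ φ n ≫ (mkIso n hi).inv :=
  HomologicalComplex.extendMap_f _ shiftEmbedding hi

lemma mk_hom_ext {Y : Cb Λ} {f g : Cb.mk A d hd b hb ⟶ Y}
    (h : ∀ n : ℕ, f.hom.f ((n : ℤ) - 1) = g.hom.f ((n : ℤ) - 1)) : f = g := by
  refine ObjectProperty.hom_ext _ (HomologicalComplex.hom_ext _ _ fun i => ?_)
  by_cases hi : ∃ n : ℕ, (n : ℤ) - 1 = i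
  · obtain ⟨n, rfl⟩ := hi
    exact h n
  · exact (mk_isZero (fun n hn => hi ⟨n, hn⟩)).eq_of_src _ _

lemma homMk_comp (φ : ∀ n, A n ⟶ A' n) (comm : ∀ n, φ (n + 1) ≫ d' n = d n ≫ φ n)
    (ψ : ∀ n, A' n ⟶ A'' n) (comm' : ∀ n, ψ (n + 1) ≫ d'' n = d' n ≫ ψ n) :
    Cb.homMk (hd := hd) (hd' := hd') (hb := hb) (hb' := hb') φ comm ≫
      Cb.homMk (hd' := hd'') (hb' := hb'') ψ comm' =
    Cb.homMk (fun n => φ n ≫ ψ n)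
      (fun n => by rw [Category.assoc, comm', ← Category.assoc, comm, Category.assoc]) := by
  refine mk_hom_ext fun n => ?_
  rw [ObjectProperty.FullSubcategory.comp_hom, HomologicalComplex.comp_f, homMk_f _ _ rfl,
    homMk_f _ _ rfl, homMk_f _ _ rfl]
  simp

lemma homMk_eq_id (φ : ∀ n, A n ⟶ A n) (comm : ∀ n, φ (n + 1) ≫ d n = d n ≫ φ n)
    (h : ∀ n, φ n = 𝟙 (A n)) :
    Cb.homMk (hd := hd) (hd' := hd) (hb := hb) (hb' := hb) φ comm = 𝟙 _ := by
  refine mk_hom_ext fun n => ?_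
  rw [homMk_f _ _ rfl, h]
  simp

/-- A retraction of complexes given in each degree. -/
def retractMk (φ : ∀ n, A n ⟶ A' n) (comm : ∀ n, φ (n + 1) ≫ d' n = d n ≫ φ n)
    (ψ : ∀ n, A' n ⟶ A n) (comm' : ∀ n, ψ (n + 1) ≫ d n = d' n ≫ ψ n)
    (h : ∀ n, φ n ≫ ψ n = 𝟙 (A n)) : Retract (Cb.mk A d hd b hb) (Cb.mk A' d' hd' b' hb') where
  i := Cb.homMk φ comm
  r := Cb.homMk ψ comm'
  retract := by rw [homMk_comp, homMk_eq_id _ _ h]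

/-- A chain map which is bijective in each degree yields an isomorphism. -/
lemma nonempty_iso_of_bijective (φ : ∀ n, A n →ₗ[Λ] A' n)
    (comm : ∀ n x, (d' n).hom.hom (φ (n + 1) x) = φ n ((d n).hom.hom x))
    (h : ∀ n, Function.Bijective (φ n)) :
    Nonempty (Cb.mk A d hd b hb ≅ Cb.mk A' d' hd' b' hb') := by
  let e : ∀ n, A n ≃ₗ[Λ] A' n := fun n => LinearEquiv.ofBijective (φ n) (h n)
  have hc : ∀ n, (FGModuleCat.ofHom (φ (n + 1)) : A (n + 1) ⟶ A' (n + 1)) ≫ d' n =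
      d n ≫ FGModuleCat.ofHom (φ n) := fun n => FGModuleCat.hom_ext (LinearMap.ext (comm n))
  have hc' : ∀ n, (FGModuleCat.ofHom (e (n + 1)).symm.toLinearMap : A' (n + 1) ⟶ A (n + 1)) ≫ d n =
      d' n ≫ FGModuleCat.ofHom (e n).symm.toLinearMap := fun n =>
    FGModuleCat.hom_ext (LinearMap.ext fun x => by
      obtain ⟨y, rfl⟩ := (e (n + 1)).surjective x
      apply (e n).injective
      change e n ((d n).hom.hom ((e (n + 1)).symm (e (n + 1) y))) =
        e n ((e n).symm ((d' n).hom.hom (φ (n + 1) y)))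
      rw [LinearEquiv.symm_apply_apply, LinearEquiv.apply_symm_apply, comm]
      rfl)
  refine ⟨⟨Cb.homMk (fun n => FGModuleCat.ofHom (φ n)) hc,
    Cb.homMk (fun n => FGModuleCat.ofHom (e n).symm.toLinearMap) hc', ?_, ?_⟩⟩
  · rw [homMk_comp]
    exact homMk_eq_id _ _ fun n => FGModuleCat.hom_ext
      (LinearMap.ext fun x => (e n).symm_apply_apply x)
  · rw [homMk_comp]
    exact homMk_eq_id _ _ fun n => FGModuleCat.hom_ext
      (LinearMap.ext fun x => (e n).apply_symm_apply x)

section Iso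

variable {X Y : FGModuleCat.{u} Λ} (e : X ≅ Y)

lemma iso_hom_inv_apply (x : X) : e.inv.hom.hom (e.hom.hom.hom x) = x :=
  LinearMap.congr_fun (congrArg (fun k => k.hom.hom) e.hom_inv_id) x

lemma iso_inv_hom_apply (y : Y) : e.hom.hom.hom (e.inv.hom.hom y) = y :=
  LinearMap.congr_fun (congrArg (fun k => k.hom.hom) e.inv_hom_id) y

lemma iso_hom_bijective : Function.Bijective e.hom.hom.hom :=
  Function.bijective_iff_has_inverse.mpr ⟨_, iso_hom_inv_apply e, iso_inv_hom_apply e⟩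

end Iso

lemma mk_subsingleton {i : ℤ} (h : ∀ n : ℕ, (n : ℤ) - 1 ≠ i) :
    Subsingleton ((Cb.mk A d hd b hb).obj.X i) := by
  have h0 := (IsZero.iff_id_eq_zero _).mp (mk_isZero (hd := hd) (hb := hb) h)
  refine ⟨fun x y => ?_⟩
  have key : ∀ z : (Cb.mk A d hd b hb).obj.X i, z = 0 := fun z =>
    LinearMap.congr_fun (congrArg (fun k => k.hom.hom) h0) z
  rw [key x, key y]

lemma homMk_surjective (φ : ∀ n, A n ⟶ A' n) (comm : ∀ n, φ (n + 1) ≫ d' n = d n ≫ φ n)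
    (h : ∀ n, Function.Surjective (φ n).hom.hom) (i : ℤ) :
    Function.Surjective
      ((Cb.homMk (hd := hd) (hd' := hd') (hb := hb) (hb' := hb') φ comm).hom.f i).hom.hom := by
  by_cases hi : ∃ n : ℕ, (n : ℤ) - 1 = i
  · obtain ⟨n, hn⟩ := hi
    rw [homMk_f _ _ hn]
    exact (iso_hom_bijective (mkIso n hn).symm).surjective.comp
      ((h n).comp (iso_hom_bijective (mkIso n hn)).surjective)
  · have := mk_subsingleton (hd := hd') (hb := hb') (fun n hn => hi ⟨n, hn⟩)
    exact Function.surjective_to_subsingleton _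

lemma exists_of_epi_comp_homMk {Y : Cb Λ} (y : Y ⟶ Cb.mk A d hd b hb)
    (φ : ∀ n, A n ⟶ A' n) (comm : ∀ n, φ (n + 1) ≫ d' n = d n ≫ φ n)
    [Epi (y ≫ Cb.homMk (hd := hd) (hd' := hd') (hb := hb) (hb' := hb') φ comm)] (n : ℕ) (z : A' n) :
    ∃ x : Y.obj.X ((n : ℤ) - 1),
      (φ n).hom.hom ((y.hom.f _ ≫ (mkIso n rfl).hom).hom.hom x) = z := by
  obtain ⟨x, hx⟩ := Cb.surjective_of_epi (y ≫ Cb.homMk (hd := hd) (hd' := hd') (hb := hb)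
    (hb' := hb') φ comm) ((n : ℤ) - 1) ((mkIso n rfl).inv.hom.hom z)
  refine ⟨x, ?_⟩
  rw [ObjectProperty.FullSubcategory.comp_hom, HomologicalComplex.comp_f, homMk_f _ _ rfl] at hx
  have := congrArg (fun t => (mkIso (hd := hd') (hb := hb') n rfl).hom.hom.hom t) hx
  exact (iso_inv_hom_apply (mkIso (hd := hd') (hb := hb') n rfl) _).symm.trans
    (this.trans (iso_inv_hom_apply (mkIso (hd := hd') (hb := hb') n rfl) _))

/-- Essentiality is reduced to graded submodules: `h` is applied to the degreewise images of `y`,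
which are closed under the differential and, together with the kernel of `φ`, span each degree. -/
lemma epi_of_epi_comp_homMk (φ : ∀ n, A n ⟶ A' n) (comm : ∀ n, φ (n + 1) ≫ d' n = d n ≫ φ n)
    (h : ∀ I : ∀ n, Submodule Λ (A n), (∀ n, ∀ x ∈ I (n + 1), (d n).hom.hom x ∈ I n) →
      (∀ n z, ∃ x ∈ I n, (φ n).hom.hom x = (φ n).hom.hom z) → ∀ n, I n = ⊤)
    {Y : Cb Λ} (y : Y ⟶ Cb.mk A d hd b hb)
    (hy : Epi (y ≫ Cb.homMk (hd := hd) (hd' := hd') (hb := hb) (hb' := hb') φ comm)) : Epi y := by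
  let ψ : ∀ n : ℕ, Y.obj.X ((n : ℤ) - 1) ⟶ A n := fun n => y.hom.f _ ≫ (Cb.mkIso n rfl).hom
  have hψ : ∀ n : ℕ, ψ (n + 1) ≫ d n = Y.obj.d _ _ ≫ ψ n := fun n => by
    simp only [ψ, Category.assoc]
    rw [← y.hom.comm_assoc, mk_d (n := n) rfl rfl]
    simp only [Category.assoc, Iso.inv_hom_id, Category.comp_id]
  have htop := h (fun n => LinearMap.range (ψ n).hom.hom)
    (by
      rintro n _ ⟨x, rfl⟩
      exact ⟨(Y.obj.d _ _).hom.hom x,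
        (LinearMap.congr_fun (congrArg (fun k => k.hom.hom) (hψ n)) x).symm⟩)
    (fun n z => by
      obtain ⟨x, hx⟩ := exists_of_epi_comp_homMk (hd' := hd') (hb' := hb') y φ comm n ((φ n).hom.hom z)
      exact ⟨_, ⟨x, rfl⟩, hx⟩)
  refine Cb.epi_of_surjective _ fun i => ?_
  by_cases hi : ∃ n : ℕ, (n : ℤ) - 1 = i
  · obtain ⟨n, rfl⟩ := hi
    intro z
    obtain ⟨x, hx⟩ := LinearMap.range_eq_top.mp (htop n) ((mkIso n rfl).hom.hom.hom z)
    exact ⟨x, (iso_hom_bijective (mkIso n rfl)).injective hx⟩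
  · have := mk_subsingleton (hd := hd) (hb := hb) (fun n hn => hi ⟨n, hn⟩)
    exact Function.surjective_to_subsingleton _

lemma isKernelOf_homMk (φ : ∀ n, A n ⟶ A' n) (comm : ∀ n, φ (n + 1) ≫ d' n = d n ≫ φ n)
    (ψ : ∀ n, A' n ⟶ A'' n) (comm' : ∀ n, ψ (n + 1) ≫ d'' n = d' n ≫ ψ n)
    (hφ : ∀ n, Function.Injective (φ n).hom.hom)
    (h : ∀ n, LinearMap.range (φ n).hom.hom = LinearMap.ker (ψ n).hom.hom) :
    IsKernelOf (Cb.homMk (hd := hd) (hd' := hd') (hb := hb) (hb' := hb') φ comm)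
      (Cb.homMk (hd' := hd'') (hb' := hb'') ψ comm') := by
  refine Cb.isKernelOf _ _ (fun i => ?_) (fun i => ?_)
  · by_cases hi : ∃ n : ℕ, (n : ℤ) - 1 = i
    · obtain ⟨n, hn⟩ := hi
      rw [homMk_f _ _ hn]
      exact (iso_hom_bijective (mkIso n hn).symm).injective.comp
        ((hφ n).comp (iso_hom_bijective (mkIso n hn)).injective)
    · have := mk_subsingleton (hd := hd) (hb := hb) (fun n hn => hi ⟨n, hn⟩)
      exact Function.injective_of_subsingleton _
  · by_cases hi : ∃ n : ℕ, (n : ℤ) - 1 = i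
    · obtain ⟨n, hn⟩ := hi
      rw [homMk_f _ _ hn, homMk_f _ _ hn]
      ext x
      have h1 : (mkIso n hn).hom.hom.hom x ∈ LinearMap.range (φ n).hom.hom ↔
        (mkIso n hn).hom.hom.hom x ∈ LinearMap.ker (ψ n).hom.hom := by rw [h n]
      constructor
      · rintro ⟨y, rfl⟩
        change (mkIso n hn).inv.hom.hom ((ψ n).hom.hom ((mkIso n hn).hom.hom.hom _)) = 0
        have h2 := h1.mp ⟨(mkIso n hn).hom.hom.hom y, (iso_inv_hom_apply (mkIso n hn) _).symm⟩
        rw [LinearMap.mem_ker] at h2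
        rw [h2, map_zero]
      · intro hx
        have hx' : (mkIso n hn).inv.hom.hom ((ψ n).hom.hom ((mkIso n hn).hom.hom.hom x)) = 0 := hx
        have h2 : (ψ n).hom.hom ((mkIso n hn).hom.hom.hom x) = 0 :=
          (iso_hom_bijective (mkIso n hn).symm).injective (hx'.trans (map_zero _).symm)
        obtain ⟨y, hy⟩ := h1.mpr h2
        refine ⟨(mkIso n hn).inv.hom.hom y, ?_⟩
        change (mkIso n hn).inv.hom.hom ((φ n).hom.hom
          ((mkIso n hn).hom.hom.hom ((mkIso n hn).inv.hom.hom y))) = x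
        rw [iso_inv_hom_apply, hy]
        exact iso_hom_inv_apply (mkIso n hn) x
    · have := mk_subsingleton (hd := hd') (hb := hb') (fun n hn => hi ⟨n, hn⟩)
      exact Subsingleton.elim _ _

/-- Construction of a chain map out of `Cb.mk A`. -/
lemma exists_desc {Y : Cb Λ} (φ : ∀ n : ℕ, A n ⟶ Y.obj.X ((n : ℤ) - 1))
    (comm : ∀ n : ℕ, φ (n + 1) ≫ Y.obj.d _ _ = d n ≫ φ n)
    (bot : ∀ j, φ 0 ≫ Y.obj.d _ j = 0) :
    ∃ f : Cb.mk A d hd b hb ⟶ Y, ∀ n : ℕ, f.hom.f ((n : ℤ) - 1) = (mkIso n rfl).hom ≫ φ n := by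
  classical
  let f : ∀ i, (Cb.mk A d hd b hb).obj.X i ⟶ Y.obj.X i := fun i =>
    if h : ∃ n : ℕ, (n : ℤ) - 1 = i then
      (mkIso h.choose h.choose_spec).hom ≫ φ h.choose ≫ eqToHom (by rw [h.choose_spec]) else 0
  have hf : ∀ n : ℕ, f ((n : ℤ) - 1) = (mkIso n rfl).hom ≫ φ n := by
    intro n
    have key : ∀ (k : ℕ) (hk : (k : ℤ) - 1 = (n : ℤ) - 1),
        (mkIso (A := A) (d := d) (hd := hd) (hb := hb) k hk).hom ≫ φ k ≫
          eqToHom (by rw [hk]) = (mkIso n rfl).hom ≫ φ n := by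
      intro k hk
      obtain rfl : k = n := by omega
      simp
    have h : ∃ k : ℕ, (k : ℤ) - 1 = (n : ℤ) - 1 := ⟨n, rfl⟩
    simp only [f, dif_pos h]
    exact key _ h.choose_spec
  refine ⟨ObjectProperty.homMk ⟨f, fun i j hij => ?_⟩, hf⟩
  by_cases hi : ∃ n : ℕ, (n : ℤ) - 1 = i
  · obtain ⟨n, rfl⟩ := hi
    have hij' : j + 1 = (n : ℤ) - 1 := hij
    rcases n with _ | n
    · have hz := mk_isZero (hd := hd) (hb := hb) (i := j) (fun k hk => by omega)
      rw [hf, Category.assoc, bot, comp_zero]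
      exact (by rw [hz.eq_of_tgt ((Cb.mk A d hd b hb).obj.d _ j) 0, zero_comp])
    · obtain rfl : j = (n : ℤ) - 1 := by push_cast at hij'; omega
      rw [hf, hf, mk_d rfl rfl]
      simp only [Category.assoc, Iso.inv_hom_id_assoc, comm]
  · exact (mk_isZero (fun n hn => hi ⟨n, hn⟩)).eq_of_src _ _

/-- A contractible complex of projective modules is a projective object of `C^b(Λ)`. -/
lemma projective_mk (hP : ∀ n, Module.Projective Λ (A n)) (s : ∀ n, A n ⟶ A (n + 1))
    (h0 : s 0 ≫ d 0 = 𝟙 _) (hs : ∀ n, d n ≫ s n + s (n + 1) ≫ d (n + 1) = 𝟙 _) :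
    Projective (Cb.mk A d hd b hb) := by
  refine ⟨fun {E Y} f e he => ?_⟩
  have hlift : ∀ n : ℕ, ∃ ψ : A n ⟶ E.obj.X ((n : ℤ) - 1),
      ψ ≫ e.hom.f _ = (mkIso n rfl).inv ≫ f.hom.f _ := fun n => by
    obtain ⟨ψ, hψ⟩ := Module.projective_lifting_property (e.hom.f ((n : ℤ) - 1)).hom.hom
      ((mkIso n rfl).inv ≫ f.hom.f _ : A n ⟶ _).hom.hom (Cb.surjective_of_epi e _)
    exact ⟨FGModuleCat.ofHom ψ, FGModuleCat.hom_ext hψ⟩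
  choose ψ hψ using hlift
  -- The degreewise lifts `ψ` need not commute with differentials. Weaving in the contraction, as
  -- dsψ + sψd, gives a chain map, which still lifts `f` because `f` is a chain map and ds + sd = 1.
  let φ : ∀ n : ℕ, A n ⟶ E.obj.X ((n : ℤ) - 1) := fun n => match n with
    | 0 => s 0 ≫ ψ 1 ≫ E.obj.d _ _
    | n + 1 => d n ≫ s n ≫ ψ (n + 1) + s (n + 1) ≫ ψ (n + 2) ≫ E.obj.d _ _
  have hdφ : ∀ n, d n ≫ φ n = d n ≫ s n ≫ ψ (n + 1) ≫ E.obj.d _ _ := fun n => by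
    rcases n with _ | n
    · rfl
    · simp only [φ, Preadditive.comp_add, reassoc_of% hd, zero_comp, zero_add]
  obtain ⟨l, hl⟩ := exists_desc (hd := hd) (hb := hb) φ (fun n => by
      rw [hdφ]
      simp [φ]) (fun j => by simp [φ])
  refine ⟨l, mk_hom_ext fun n => ?_⟩
  have hf : ∀ n : ℕ, (mkIso (n + 1) rfl).inv ≫ f.hom.f _ ≫ Y.obj.d _ _ =
      d n ≫ (mkIso n rfl).inv ≫ f.hom.f _ := fun n => by
    rw [f.hom.comm, mk_d (n := n) rfl rfl]
    simp
  have key : φ n ≫ e.hom.f _ = (mkIso n rfl).inv ≫ f.hom.f _ := by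
    rcases n with _ | n
    · simp only [φ, Category.assoc, ← e.hom.comm]
      rw [reassoc_of% (hψ 1), hf, reassoc_of% h0]
    · simp only [φ, Category.assoc, Preadditive.add_comp, ← e.hom.comm]
      rw [reassoc_of% (hψ (n + 2)), hf, hψ, ← Category.assoc, ← Category.assoc (s (n + 1)),
        ← Preadditive.add_comp, hs, Category.id_comp]
  rw [ObjectProperty.FullSubcategory.comp_hom, HomologicalComplex.comp_f, hl, Category.assoc, key,
    Iso.hom_inv_id_assoc]

end Cb

namespace ResolutionData

/-! ### The projective cover of a truncated projective resolution and its kernel -/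

section Cover

set_option linter.unusedSectionVars false

variable {Λ : Type u} [Ring Λ] {M : FGModuleCat.{u} Λ} {m : ℕ} (T : ResolutionData M m)

lemma projective_P (i : ℕ) : Module.Projective Λ (T.P i) := by
  rcases i with _ | i
  · exact T.ε_cover.projective
  · exact (T.f_cover i).projective

lemma isSuperfluous_ker_f (i : ℕ) : IsSuperfluous (LinearMap.ker (T.f i)) :=
  (T.f_cover i).isSuperfluous_ker_of_rangeRestrict

variable [IsArtinianRing Λ]

namespace SummandCovers

variable {T} (C : T.SummandCovers)

lemma projective_PQ (i : ℕ) : Module.Projective Λ (C.PQ i) := (C.q_cover i).projective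

lemma projective_prod (i : ℕ) : Module.Projective Λ (C.PQ i × T.P (i + 1)) := by
  have := C.projective_PQ i
  have := T.projective_P (i + 1)
  infer_instance

lemma ker_iq (i : ℕ) : LinearMap.ker (C.iq i) = LinearMap.ker (C.q i) :=
  LinearMap.ker_comp_of_ker_eq_bot _ (Submodule.ker_subtype _)

lemma range_iq (i : ℕ) : LinearMap.range (C.iq i) = T.Q i := by
  rw [iq, LinearMap.range_comp, LinearMap.range_eq_top.mpr (C.q_cover i).surjective,
    Submodule.map_top, Submodule.range_subtype]

/-- Directness of the sum of `Q i` and the range of `f i` enters here. The splitting makes the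
kernel superfluous and isolates ΩQ as a summand of the next syzygy. -/
lemma ker_iqf (i : ℕ) :
    LinearMap.ker (C.iqf i) = (LinearMap.ker (C.q i)).prod (LinearMap.ker (T.f i)) := by
  rw [iqf, LinearMap.ker_coprod_of_disjoint_range, ker_iq]
  rw [range_iq]
  exact T.disjoint i

lemma range_iqf (i : ℕ) : LinearMap.range (C.iqf i) = T.Q i ⊔ LinearMap.range (T.f i) := by
  rw [iqf, LinearMap.range_coprod, range_iq]

lemma isSuperfluous_ker_iqf (i : ℕ) : IsSuperfluous (LinearMap.ker (C.iqf i)) := by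
  rw [ker_iqf]
  exact (C.q_cover i).isSuperfluous_ker.prod (T.isSuperfluous_ker_f i)

lemma range_iqf_zero : LinearMap.range (C.iqf 0) = LinearMap.ker T.ε := by
  rw [range_iqf, T.ker_ε]

lemma range_iqf_succ (i : ℕ) : LinearMap.range (C.iqf (i + 1)) = LinearMap.ker (T.f i) := by
  rw [range_iqf, T.ker_f]

/-- The contraction moves the second half of each degree identically onto the first half of the
degree above, and in degree -1 moves all of P_0. -/
lemma projective_cover : Projective C.cover := by
  refine Cb.projective_mk (fun n => ?_) (fun n => match n with
    | 0 => FGModuleCat.ofHom (LinearMap.inl Λ (T.P 0) (C.PQ 0 × T.P 1))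
    | 1 => FGModuleCat.ofHom (LinearMap.inl Λ _ _ ∘ₗ LinearMap.snd Λ (T.P 0) (C.PQ 0 × T.P 1))
    | k + 2 => FGModuleCat.ofHom (LinearMap.inl Λ _ _ ∘ₗ
        LinearMap.snd Λ (C.PQ k × T.P (k + 1)) (C.PQ (k + 1) × T.P (k + 2)))) ?_ (fun n => ?_)
  · have := T.projective_P
    have := C.projective_PQ
    match n with
    | 0 => exact T.projective_P 0
    | 1 => exact inferInstanceAs (Module.Projective Λ (T.P 0 × (C.PQ 0 × T.P 1)))
    | k + 2 => exact inferInstanceAs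
        (Module.Projective Λ ((C.PQ k × T.P (k + 1)) × (C.PQ (k + 1) × T.P (k + 2))))
  · exact FGModuleCat.hom_ext (LinearMap.ext fun x => rfl)
  · refine FGModuleCat.hom_ext (LinearMap.ext fun x => ?_)
    match n, x with
    | 0, (a, b) =>
      change (a, (0 : C.PQ 0 × T.P 1)) + ((0 : T.P 0), b) = (a, b)
      simp
    | 1, (a, b) =>
      change (a, (0 : C.PQ 1 × T.P 2)) + ((0 : C.PQ 0 × T.P 1), b) = (a, b)
      simp
    | k + 2, (a, b) =>
      change (a, (0 : C.PQ (k + 2) × T.P (k + 3))) + ((0 : C.PQ (k + 1) × T.P (k + 2)), b) = (a, b)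
      simp

lemma g_surjective (n : ℕ) : Function.Surjective (C.g n).hom.hom := by
  match n with
  | 0 => exact T.ε_cover.surjective
  | 1 => exact fun (y : T.P 0) => ⟨(y, (0 : C.PQ 0 × T.P 1)), by
      change y + C.iqf 0 0 = y
      rw [map_zero, add_zero]⟩
  | k + 2 =>
    rintro ⟨y, z⟩
    obtain ⟨x, rfl⟩ := (C.q_cover k).surjective y
    refine ⟨((x, z), (0 : C.PQ (k + 1) × T.P (k + 2))), ?_⟩
    change (C.q k x + 0, z + C.iqf (k + 1) 0) = (C.q k x, z)
    rw [map_zero, add_zero, add_zero]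

/-- A graded submodule of `P_X` which is closed under the differential and supplements the kernel
of `g` is everything. -/
lemma eq_top_of_sup_ker_g (I : ∀ n, Submodule Λ (C.coverX n))
    (hI : ∀ n, ∀ x ∈ I (n + 1), (C.coverD n).hom.hom x ∈ I n)
    (hg : ∀ n z, ∃ x ∈ I n, (C.g n).hom.hom x = (C.g n).hom.hom z) (n : ℕ) : I n = ⊤ := by
  -- First halves are filled: if an element of `I 1` with first entry `a'` has the same image under
  -- `g` as `(a, 0)`, then `a - a'` lies in the range of `iqf 0`, inside the superfluous `ker ε`.
  have h1 : ∀ a : T.P 0, ∃ b : C.PQ 0 × T.P 1, ((a, b) : T.P 0 × (C.PQ 0 × T.P 1)) ∈ I 1 := by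
    let J : Submodule Λ (T.P 0 × (C.PQ 0 × T.P 1)) := I 1
    have hJ : J.map (LinearMap.fst Λ _ _) = ⊤ := by
      refine T.ε_cover.superfluous _ (eq_top_iff.mpr fun a _ => ?_)
      obtain ⟨⟨a', x⟩, hx, hxa⟩ := hg 1 ((a, 0) : T.P 0 × (C.PQ 0 × T.P 1))
      have hxa : a' + C.iqf 0 x = a + C.iqf 0 0 := hxa
      refine Submodule.mem_sup.mpr ⟨a', ⟨_, hx, rfl⟩, a - a', ?_, by abel⟩
      rw [map_zero, add_zero] at hxa
      rw [LinearMap.mem_ker, ← hxa, add_sub_cancel_left, C.ε_iqf]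
    intro a
    obtain ⟨⟨a', x⟩, hx, rfl⟩ : a ∈ J.map (LinearMap.fst Λ _ _) := hJ ▸ Submodule.mem_top
    exact ⟨x, hx⟩
  have h2 : ∀ k (a : C.PQ k × T.P (k + 1)), ∃ b : C.PQ (k + 1) × T.P (k + 2),
      ((a, b) : (C.PQ k × T.P (k + 1)) × (C.PQ (k + 1) × T.P (k + 2))) ∈ I (k + 2) := by
    intro k
    let J : Submodule Λ ((C.PQ k × T.P (k + 1)) × (C.PQ (k + 1) × T.P (k + 2))) := I (k + 2)
    have hJ : J.map (LinearMap.fst Λ _ _) = ⊤ := by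
      refine C.isSuperfluous_ker_iqf k _ (eq_top_iff.mpr fun a _ => ?_)
      obtain ⟨⟨a', x⟩, hx, hxa⟩ := hg (k + 2)
        ((a, 0) : (C.PQ k × T.P (k + 1)) × (C.PQ (k + 1) × T.P (k + 2)))
      have hxa : (C.q k a'.1 + 0, a'.2 + C.iqf (k + 1) x) =
        (C.q k a.1 + 0, a.2 + C.iqf (k + 1) 0) := hxa
      refine Submodule.mem_sup.mpr ⟨a', ⟨_, hx, rfl⟩, a - a', ?_, by abel⟩
      rw [map_zero, add_zero, add_zero, add_zero, Prod.mk.injEq] at hxa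
      rw [C.ker_iqf]
      refine ⟨?_, ?_⟩
      · change C.q k (a.1 - a'.1) = 0
        rw [map_sub, hxa.1, sub_self]
      · change T.f k (a.2 - a'.2) = 0
        rw [← hxa.2, add_sub_cancel_left, C.f_iqf]
    intro a
    obtain ⟨⟨a', x⟩, hx, rfl⟩ : a ∈ J.map (LinearMap.fst Λ _ _) := hJ ▸ Submodule.mem_top
    exact ⟨x, hx⟩
  match n with
  | 0 =>
    refine eq_top_iff.mpr fun a _ => ?_
    obtain ⟨b, hb⟩ := h1 a
    exact hI 0 _ hb
  | 1 =>
    refine eq_top_iff.mpr fun x _ => ?_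
    obtain ⟨a, c⟩ := x
    obtain ⟨b, hb⟩ := h1 a
    -- Second halves are reached by the differential: `c - b` is the first entry of an element of
    -- `I` one degree higher.
    obtain ⟨b', hb'⟩ := h2 0 (c - b)
    have h3 : ((0 : T.P 0), c - b) ∈ I 1 := hI 1 _ hb'
    have h4 : ((a, b) : T.P 0 × (C.PQ 0 × T.P 1)) + ((0 : T.P 0), c - b) = (a, c) := by simp
    exact h4 ▸ (I 1).add_mem hb h3
  | k + 2 =>
    refine eq_top_iff.mpr fun x _ => ?_
    obtain ⟨a, c⟩ := x
    obtain ⟨b, hb⟩ := h2 k a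
    obtain ⟨b', hb'⟩ := h2 (k + 1) (c - b)
    have h3 : ((0 : C.PQ k × T.P (k + 1)), c - b) ∈ I (k + 2) := hI (k + 2) _ hb'
    have h4 : ((a, b) : (C.PQ k × T.P (k + 1)) × (C.PQ (k + 1) × T.P (k + 2))) +
      ((0 : C.PQ k × T.P (k + 1)), c - b) = (a, c) := by simp
    exact h4 ▸ (I (k + 2)).add_mem hb h3

lemma isProjectiveCover_coverMap : IsProjectiveCover C.coverMap := by
  exact ⟨C.projective_cover,
    Cb.epi_of_surjective _ (Cb.homMk_surjective _ _ C.g_surjective),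
    fun y hy => Cb.epi_of_epi_comp_homMk C.g C.g_comm C.eq_top_of_sup_ker_g y hy⟩

lemma injective_neg_one_pow_smul {A B : Type*} [AddCommGroup A] [Module Λ A] [AddCommGroup B]
    [Module Λ B] {φ : A →ₗ[Λ] B} (k : ℕ) (h : Function.Injective φ) :
    Function.Injective ((-1 : ℤ) ^ k • φ) := by
  rcases neg_one_pow_eq_or ℤ k with hk | hk <;> rw [hk]
  · rwa [one_smul]
  · rw [neg_one_smul]
    exact fun x y hxy => h (neg_injective hxy)

lemma range_neg_one_pow_smul {A B : Type*} [AddCommGroup A] [Module Λ A] [AddCommGroup B]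
    [Module Λ B] (φ : A →ₗ[Λ] B) (k : ℕ) :
    LinearMap.range ((-1 : ℤ) ^ k • φ) = LinearMap.range φ := by
  rcases neg_one_pow_eq_or ℤ k with hk | hk <;> rw [hk]
  · rw [one_smul]
  · rw [neg_one_smul, LinearMap.range_neg]

lemma h_injective (n : ℕ) : Function.Injective (C.h n).hom.hom := by
  match n with
  | 0 => exact fun x y hxy => Subtype.ext (neg_injective hxy)
  | 1 => exact fun x y hxy => congrArg Prod.snd hxy
  | k + 2 =>
    refine injective_neg_one_pow_smul (k + 1) ?_
    rintro ⟨w, x⟩ ⟨w', x'⟩ hxy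
    have h1 : x = x' := congrArg Prod.snd hxy
    have h2 : -(w : C.PQ k) = -(w' : C.PQ k) := congrArg (fun t => t.1.1) hxy
    exact Prod.ext (Subtype.ext (neg_injective h2)) h1

lemma range_h (n : ℕ) : LinearMap.range (C.h n).hom.hom = LinearMap.ker (C.g n).hom.hom := by
  match n with
  | 0 =>
    change LinearMap.range (-(LinearMap.ker T.ε).subtype) = LinearMap.ker T.ε
    rw [LinearMap.range_neg, Submodule.range_subtype]
  | 1 =>
    change LinearMap.range (LinearMap.prod (-(C.iqf 0)) LinearMap.id) =
      LinearMap.ker (LinearMap.coprod LinearMap.id (C.iqf 0))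
    ext ⟨a, x⟩
    constructor
    · rintro ⟨y, hy⟩
      obtain ⟨rfl, rfl⟩ : -(C.iqf 0 y) = a ∧ y = x := Prod.mk.inj hy
      simp
    · intro h
      have h : a + C.iqf 0 x = 0 := h
      exact ⟨x, Prod.ext (neg_eq_of_add_eq_zero_left h) rfl⟩
  | k + 2 =>
    refine (range_neg_one_pow_smul _ (k + 1)).trans ?_
    change _ = LinearMap.ker (LinearMap.coprod
      (LinearMap.prodMap (C.q k) LinearMap.id) (LinearMap.prod 0 (C.iqf (k + 1))))
    ext ⟨⟨a, b⟩, x⟩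
    constructor
    · rintro ⟨⟨w, y⟩, hy⟩
      obtain ⟨h1, rfl⟩ : -((w : C.PQ k), C.iqf (k + 1) y) = (a, b) ∧ y = x := Prod.mk.inj hy
      obtain ⟨rfl, rfl⟩ : -(w : C.PQ k) = a ∧ -(C.iqf (k + 1) y) = b := Prod.mk.inj h1
      have hw : C.q k w = 0 := w.2
      refine Prod.ext ?_ (neg_add_cancel _)
      change C.q k (-w) + 0 = 0
      rw [map_neg, hw, neg_zero, add_zero]
    · intro h
      obtain ⟨h1, h2⟩ : C.q k a + 0 = 0 ∧ b + C.iqf (k + 1) x = 0 := Prod.mk.inj h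
      rw [add_zero] at h1
      refine ⟨(⟨-a, ?_⟩, x), ?_⟩
      · rw [LinearMap.mem_ker, map_neg, h1, neg_zero]
      · exact Prod.ext (Prod.ext (neg_neg a) (neg_eq_of_add_eq_zero_left h2)) rfl

lemma isKernelOf_syzygyMap : IsKernelOf C.syzygyMap C.coverMap :=
  Cb.isKernelOf_homMk _ _ _ _ C.h_injective C.range_h

end SummandCovers

end Cover

end ResolutionData

/-! ### Products of submodules and maps into the second factor. -/

section ProdLemmas

variable {Λ : Type u} [Ring Λ] {A B D : Type*} [AddCommGroup A] [Module Λ A] [AddCommGroup B]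
  [Module Λ B] [AddCommGroup D] [Module Λ D]

lemma ker_inr_comp (f : D →ₗ[Λ] B) :
    LinearMap.ker (LinearMap.inr Λ A B ∘ₗ f) = LinearMap.ker f :=
  LinearMap.ker_comp_of_ker_eq_bot _ (LinearMap.ker_eq_bot.mpr LinearMap.inr_injective)

lemma prod_bot_sup_range_inr_comp (N : Submodule Λ A) (f : D →ₗ[Λ] B) :
    N.prod ⊥ ⊔ LinearMap.range (LinearMap.inr Λ A B ∘ₗ f) = N.prod (LinearMap.range f) := by
  ext ⟨a, b⟩
  constructor
  · intro h
    obtain ⟨⟨x, y⟩, ⟨hx, hy⟩, _, ⟨z, rfl⟩, h⟩ := Submodule.mem_sup.mp h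
    obtain rfl : y = 0 := hy
    obtain ⟨rfl, rfl⟩ : x + 0 = a ∧ 0 + f z = b := Prod.mk.inj h
    exact ⟨by simpa using hx, by simp⟩
  · rintro ⟨ha, z, rfl⟩
    exact Submodule.mem_sup.mpr ⟨(a, 0), ⟨ha, rfl⟩, (0, f z), ⟨z, rfl⟩, by simp⟩

lemma disjoint_prod_bot_range_inr_comp (N : Submodule Λ A) (f : D →ₗ[Λ] B) :
    Disjoint (N.prod ⊥) (LinearMap.range (LinearMap.inr Λ A B ∘ₗ f)) := by
  rw [Submodule.disjoint_def]
  rintro _ ⟨_, h⟩ ⟨z, rfl⟩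
  exact Prod.ext rfl h

/-- The submodule `N ⊕ 0` of `A ⊕ B` is isomorphic to `N`. -/
def prodBotEquiv (N : Submodule Λ A) : N ≃ₗ[Λ] N.prod (⊥ : Submodule Λ B) where
  toFun x := ⟨((x : A), 0), x.2, rfl⟩
  invFun x := ⟨x.1.1, x.2.1⟩
  map_add' _ _ := Subtype.ext (Prod.ext rfl (add_zero _).symm)
  map_smul' _ _ := Subtype.ext (Prod.ext rfl (smul_zero _).symm)
  left_inv _ := rfl
  right_inv x := Subtype.ext (Prod.ext rfl (show (0 : B) = x.1.2 from x.2.2.symm))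

/-- The underlying module of a product of submodules. -/
def submoduleProdEquiv (N : Submodule Λ A) (N' : Submodule Λ B) : N.prod N' ≃ₗ[Λ] N × N' where
  toFun x := (⟨x.1.1, x.2.1⟩, ⟨x.1.2, x.2.2⟩)
  invFun x := ⟨(x.1, x.2), x.1.2, x.2.2⟩
  map_add' _ _ := rfl
  map_smul' _ _ := rfl
  left_inv _ := rfl
  right_inv _ := rfl

end ProdLemmas

/-! ### The kernel of the projective cover as resolution data for ΩM. -/

namespace ResolutionData

section Syzygy

set_option linter.unusedSectionVars false

variable {Λ : Type u} [Ring Λ] [IsArtinianRing Λ] {M : FGModuleCat.{u} Λ} {m : ℕ}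
  {T : ResolutionData M m}

namespace SummandCovers

variable (C : T.SummandCovers)

lemma iqf_cover (i : ℕ) {A : Type*} [AddCommGroup A] [Module Λ A] :
    IsModuleProjectiveCover (LinearMap.inr Λ A (T.P i) ∘ₗ C.iqf i).rangeRestrict := by
  have := C.projective_prod i
  exact isModuleProjectiveCover_rangeRestrict (by
    rw [ker_inr_comp]
    exact C.isSuperfluous_ker_iqf i)

/-- The projective cover `P_{Q_1} ⊕ P_1 → Ω M`. -/
def syzygyε : (C.PQ 0 × T.P 1) →ₗ[Λ] LinearMap.ker T.ε :=
  LinearMap.codRestrict (LinearMap.ker T.ε) (C.iqf 0) C.ε_iqf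

lemma ker_syzygyε : LinearMap.ker C.syzygyε = LinearMap.ker (C.iqf 0) :=
  LinearMap.ker_codRestrict _ _ _

lemma syzygyε_cover : IsModuleProjectiveCover C.syzygyε := by
  refine ⟨C.projective_prod 0, ?_, ?_⟩
  · rintro ⟨y, hy⟩
    rw [← C.range_iqf_zero] at hy
    obtain ⟨x, rfl⟩ := hy
    exact ⟨x, rfl⟩
  · rw [ker_syzygyε]
    exact C.isSuperfluous_ker_iqf 0

/-- The resolution of `Ω M` whose complex is `Ω X`. -/
def syzygyData : ResolutionData T.syzygyModule m where
  P i := FGModuleCat.of Λ (C.PQ i × T.P (i + 1))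
  P_eq_zero i hi := by
    have := C.PQ_subsingleton i hi
    have := T.P_eq_zero (i + 1) (by omega)
    exact inferInstanceAs (Subsingleton (C.PQ i × T.P (i + 1)))
  ε := C.syzygyε
  f i := LinearMap.inr Λ (C.PQ i) (T.P (i + 1)) ∘ₗ C.iqf (i + 1)
  -- The kernel to be decomposed is `ker (q i) × ker (f i)` by `ker_iqf`. The range of `iqf (i + 1)`
  -- is exactly the second factor, so the first is what splits off.
  Q i := (LinearMap.ker (C.q i)).prod ⊥
  ε_cover := C.syzygyε_cover
  f_cover i := C.iqf_cover (i + 1)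
  disjoint i := disjoint_prod_bot_range_inr_comp _ _
  ker_ε := (prod_bot_sup_range_inr_comp _ _).trans
    (by rw [C.range_iqf_succ, C.ker_syzygyε, C.ker_iqf])
  ker_f i := by
    refine (prod_bot_sup_range_inr_comp _ _).trans ?_
    rw [ker_inr_comp, C.range_iqf_succ, C.ker_iqf]

lemma nonempty_syzygy_iso : Nonempty (C.syzygy ≅ C.syzygyData.complex) := by
  let e : ∀ k, (LinearMap.ker (C.q k) × (C.PQ (k + 1) × T.P (k + 2))) ≃ₗ[Λ]
      (C.syzygyData.Q k × (C.PQ (k + 1) × T.P (k + 2))) :=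
    fun k => (prodBotEquiv (LinearMap.ker (C.q k))).prodCongr (LinearEquiv.refl Λ _)
  refine Cb.nonempty_iso_of_bijective (fun n => match n with
    | 0 => LinearMap.id
    | 1 => LinearMap.id
    | k + 2 => (e k).toLinearMap) (fun n => ?_) (fun n => ?_)
  · match n with
    | 0 => exact fun x => rfl
    | 1 =>
      rintro ⟨w, x⟩
      change ((w : C.PQ 0), (0 : T.P 1)) + ((0 : C.PQ 0), C.iqf 1 x) = ((w : C.PQ 0), C.iqf 1 x)
      rw [Prod.mk_add_mk, add_zero, zero_add]
    | k + 2 =>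
      rintro ⟨w, x⟩
      refine Prod.ext (Subtype.ext rfl) ?_
      change ((w : C.PQ (k + 1)), (0 : T.P (k + 2))) + ((0 : C.PQ (k + 1)), C.iqf (k + 2) x) =
        ((w : C.PQ (k + 1)), C.iqf (k + 2) x)
      rw [Prod.mk_add_mk, add_zero, zero_add]
  · match n with
    | 0 => exact Function.bijective_id
    | 1 => exact Function.bijective_id
    | k + 2 => exact (e k).bijective

/-- The resolution of `M` obtained by replacing each summand `Q_k` by its projective cover. -/
def prolong : ResolutionData M (m + 1) where
  P
    | 0 => T.P 0
    | i + 1 => FGModuleCat.of Λ (C.PQ i × T.P (i + 1))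
  P_eq_zero i hi := by
    obtain ⟨i, rfl⟩ : ∃ k, i = k + 1 := ⟨i - 1, by omega⟩
    have := C.PQ_subsingleton i (by omega)
    have := T.P_eq_zero (i + 1) (by omega)
    exact inferInstanceAs (Subsingleton (C.PQ i × T.P (i + 1)))
  ε := T.ε
  f
    | 0 => C.iqf 0
    | i + 1 => LinearMap.inr Λ (C.PQ i) (T.P (i + 1)) ∘ₗ C.iqf (i + 1)
  Q
    -- The covers of Q_1 and R_1 together cover all of `ker ε`, so nothing splits off at index 0;
    -- the new summands ΩQ appear one index later.
    | 0 => ⊥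
    | i + 1 => ((LinearMap.ker (C.q i)).prod ⊥ : Submodule Λ (C.PQ i × T.P (i + 1)))
  ε_cover := T.ε_cover
  f_cover
    | 0 => by
      have := C.projective_prod 0
      exact isModuleProjectiveCover_rangeRestrict (C.isSuperfluous_ker_iqf 0)
    | i + 1 => C.iqf_cover (i + 1)
  disjoint
    | 0 => disjoint_bot_left
    | i + 1 => disjoint_prod_bot_range_inr_comp _ _
  ker_ε := by
    rw [bot_sup_eq]
    exact C.range_iqf_zero
  ker_f
    | 0 => (prod_bot_sup_range_inr_comp _ _).trans (by rw [C.range_iqf_succ, C.ker_iqf])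
    | i + 1 => by
      refine (prod_bot_sup_range_inr_comp _ _).trans ?_
      rw [ker_inr_comp, C.range_iqf_succ, C.ker_iqf]

end SummandCovers

end Syzygy

end ResolutionData

/-! ### Resolutions of the split-off summands as retracts of iterated syzygies. -/

namespace ResolutionData

section Marking

set_option linter.unusedSectionVars false

variable {Λ : Type u} [Ring Λ]

/-- A marking of `T` by `E` at the index `j` presents the projectives `E.P i` and the summands
`E.Q i` of a resolution `E` compatibly as retracts of `T.P (j + i)` and `T.Q (j + i)`. -/
structure Marking {M N : FGModuleCat.{u} Λ} {m a : ℕ} (T : ResolutionData M m) (j : ℕ)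
    (E : ResolutionData N a) where
  -- Carrying `n` with a proof of `n = j + i` avoids transport along equalities of indices. No map
  -- between `N` and `M` is included, since for `j > 0` the marked resolution begins above the
  -- augmentation of `T`.
  α : ∀ i n, n = j + i → (E.P i →ₗ[Λ] T.P n)
  ρ : ∀ i n, n = j + i → (T.P n →ₗ[Λ] E.P i)
  ρ_α : ∀ i n h x, ρ i n h (α i n h x) = x
  f_α : ∀ i n h h' x, T.f n (α (i + 1) (n + 1) h' x) = α i n h (E.f i x)
  f_ρ : ∀ i n h h' x, E.f i (ρ (i + 1) (n + 1) h' x) = ρ i n h (T.f n x)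
  α_mem : ∀ i n h, ∀ x ∈ E.Q i, α i n h x ∈ T.Q n
  ρ_mem : ∀ i n h, ∀ x ∈ T.Q n, ρ i n h x ∈ E.Q i

namespace Marking

variable {M N : FGModuleCat.{u} Λ} {m a : ℕ} {T : ResolutionData M m} {j : ℕ}
  {E : ResolutionData N a} (μ : Marking T j E)

/-- The restriction of `α` to the split-off summands. -/
def αQ (i n : ℕ) (h : n = j + i) : E.Q i →ₗ[Λ] T.Q n := (μ.α i n h).restrict (μ.α_mem i n h)

/-- The restriction of `ρ` to the split-off summands. -/
def ρQ (i n : ℕ) (h : n = j + i) : T.Q n →ₗ[Λ] E.Q i := (μ.ρ i n h).restrict (μ.ρ_mem i n h)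

lemma ρQ_comp_αQ (i n : ℕ) (h : n = j + i) : μ.ρQ i n h ∘ₗ μ.αQ i n h = LinearMap.id :=
  LinearMap.ext fun _ => Subtype.ext (μ.ρ_α i n h _)

variable [IsArtinianRing Λ]

/-- A resolution marking another one at the index `0` has it as a direct summand. -/
lemma nonempty_retract (μ : Marking T 0 E) : Nonempty (Retract E.complex T.complex) := by
  have h0 : ∀ i, i = 0 + i := fun i => (zero_add i).symm
  -- The maps in degree -1 are induced on quotients: `ker ε` is the sum of `Q 0` and the range of `f
  -- 0`, both of which a marking at index 0 respects.
  obtain ⟨α₀, hα₀⟩ := exists_comp_eq_of_ker_le E.ε_cover.surjective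
    (T.ε ∘ₗ μ.α 0 0 (h0 0)) (by
      rw [← E.ker_ε]
      refine sup_le (fun x hx => ?_) ?_
      · exact T.ε_Q ⟨_, μ.α_mem 0 0 (h0 0) x hx⟩
      · rintro _ ⟨x, rfl⟩
        rw [LinearMap.mem_ker, LinearMap.comp_apply, ← μ.f_α 0 0 (h0 0) (h0 1), T.ε_f])
  obtain ⟨ρ₀, hρ₀⟩ := exists_comp_eq_of_ker_le T.ε_cover.surjective
    (E.ε ∘ₗ μ.ρ 0 0 (h0 0)) (by
      rw [← T.ker_ε]
      refine sup_le (fun x hx => ?_) ?_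
      · exact E.ε_Q ⟨_, μ.ρ_mem 0 0 (h0 0) x hx⟩
      · rintro _ ⟨x, rfl⟩
        rw [LinearMap.mem_ker, LinearMap.comp_apply, ← μ.f_ρ 0 0 (h0 0) (h0 1), E.ε_f])
  refine ⟨Cb.retractMk
    (fun n => match n with
      | 0 => FGModuleCat.ofHom α₀
      | 1 => FGModuleCat.ofHom (μ.α 0 0 (h0 0))
      | k + 2 => FGModuleCat.ofHom
          ((μ.αQ k k (h0 k)).prodMap (μ.α (k + 1) (k + 1) (h0 _)))) (fun n => ?_)
    (fun n => match n with
      | 0 => FGModuleCat.ofHom ρ₀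
      | 1 => FGModuleCat.ofHom (μ.ρ 0 0 (h0 0))
      | k + 2 => FGModuleCat.ofHom
          ((μ.ρQ k k (h0 k)).prodMap (μ.ρ (k + 1) (k + 1) (h0 _)))) (fun n => ?_)
    (fun n => ?_)⟩
  · refine FGModuleCat.hom_ext (LinearMap.ext fun x => ?_)
    match n, x with
    | 0, x => exact (LinearMap.congr_fun hα₀ x).symm
    | 1, (x, y) =>
      change μ.α 0 0 _ (x : E.P 0) + T.f 0 (μ.α 1 1 _ y) = μ.α 0 0 _ ((x : E.P 0) + E.f 0 y)
      rw [map_add, μ.f_α 0 0 (h0 0)]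
    | k + 2, (x, y) =>
      change ((0 : T.Q k), μ.α (k + 1) (k + 1) (h0 _) (x : E.P (k + 1)) +
          T.f (k + 1) (μ.α (k + 2) (k + 2) (h0 _) y)) =
        (μ.αQ k k (h0 k) 0, μ.α (k + 1) (k + 1) (h0 _) ((x : E.P (k + 1)) + E.f (k + 1) y))
      rw [map_add, μ.f_α (k + 1) (k + 1) (h0 _), map_zero]
  · refine FGModuleCat.hom_ext (LinearMap.ext fun x => ?_)
    match n, x with
    | 0, x => exact (LinearMap.congr_fun hρ₀ x).symm
    | 1, (x, y) =>
      change μ.ρ 0 0 _ (x : T.P 0) + E.f 0 (μ.ρ 1 1 _ y) = μ.ρ 0 0 _ ((x : T.P 0) + T.f 0 y)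
      rw [map_add, μ.f_ρ 0 0 (h0 0)]
    | k + 2, (x, y) =>
      change ((0 : E.Q k), μ.ρ (k + 1) (k + 1) (h0 _) (x : T.P (k + 1)) +
          E.f (k + 1) (μ.ρ (k + 2) (k + 2) (h0 _) y)) =
        (μ.ρQ k k (h0 k) 0, μ.ρ (k + 1) (k + 1) (h0 _) ((x : T.P (k + 1)) + T.f (k + 1) y))
      rw [map_add, μ.f_ρ (k + 1) (k + 1) (h0 _), map_zero]
  · refine FGModuleCat.hom_ext (LinearMap.ext fun x => ?_)
    match n, x with
    | 0, x =>
      obtain ⟨x, rfl⟩ := E.ε_cover.surjective x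
      change ρ₀ (α₀ (E.ε x)) = E.ε x
      have h1 : α₀ (E.ε x) = T.ε (μ.α 0 0 (h0 0) x) := LinearMap.congr_fun hα₀ x
      have h2 : ∀ y, ρ₀ (T.ε y) = E.ε (μ.ρ 0 0 (h0 0) y) := LinearMap.congr_fun hρ₀
      rw [h1, h2, μ.ρ_α]
    | 1, x => exact μ.ρ_α 0 0 (h0 0) x
    | k + 2, (x, y) =>
      exact Prod.ext (LinearMap.congr_fun (μ.ρQ_comp_αQ k k (h0 k)) x)
        (μ.ρ_α (k + 1) (k + 1) (h0 _) y)

/-- Passing to the syzygy moves a marking down by one and prolongs the marked resolution. -/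
lemma nonempty_syzygy (μ : Marking T (j + 1) E) (C : T.SummandCovers) (D : E.SummandCovers) :
    Nonempty (Marking C.syzygyData j D.prolong) := by
  -- The retraction of `T.Q n` onto `E.Q i` lifts to a strict retraction of their projective covers.
  choose a b hba ha hb using fun (i n : ℕ) (h : n = j + 1 + i) =>
    (D.q_cover i).exists_retract (C.q_cover n) (μ.αQ i n h) (μ.ρQ i n h) (μ.ρQ_comp_αQ i n h)
  have h1 : ∀ {i n}, n = j + i → n + 1 = j + 1 + i := fun h => by omega
  have h2 : ∀ {i n}, n = j + (i + 1) → n = j + 1 + i := fun h => by omega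
  have hα : ∀ i n h h' x, μ.α i n h (D.iqf i x) =
      C.iqf n (a i n h x.1, μ.α (i + 1) (n + 1) h' x.2) := fun i n h h' x => by
    have h3 : C.q n (a i n h x.1) = μ.αQ i n h (D.q i x.1) := LinearMap.congr_fun (ha i n h) x.1
    change μ.α i n h ((D.q i x.1 : E.P i) + E.f i x.2) =
      (C.q n (a i n h x.1) : T.P n) + T.f n (μ.α (i + 1) (n + 1) h' x.2)
    rw [h3, map_add, μ.f_α i n h]
    rfl
  have hρ : ∀ i n h h' x, μ.ρ i n h (C.iqf n x) =
      D.iqf i (b i n h x.1, μ.ρ (i + 1) (n + 1) h' x.2) := fun i n h h' x => by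
    have h3 : D.q i (b i n h x.1) = μ.ρQ i n h (C.q n x.1) := LinearMap.congr_fun (hb i n h) x.1
    change μ.ρ i n h ((C.q n x.1 : T.P n) + T.f n x.2) =
      (D.q i (b i n h x.1) : E.P i) + E.f i (μ.ρ (i + 1) (n + 1) h' x.2)
    rw [h3, map_add, μ.f_ρ i n h]
    rfl
  refine ⟨{
    α := fun i n h => match i, h with
      -- `D.prolong` keeps `E.P 0` in its index 0, so this term sits in the factor `T.P (n + 1)`;
      -- later terms are themselves products and are embedded factorwise.
      | 0, h => LinearMap.inr Λ (C.PQ n) (T.P (n + 1)) ∘ₗ μ.α 0 (n + 1) (h1 h)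
      | i + 1, h => (a i n (h2 h)).prodMap (μ.α (i + 1) (n + 1) (h1 h))
    ρ := fun i n h => match i, h with
      | 0, h => μ.ρ 0 (n + 1) (h1 h) ∘ₗ LinearMap.snd Λ (C.PQ n) (T.P (n + 1))
      | i + 1, h => (b i n (h2 h)).prodMap (μ.ρ (i + 1) (n + 1) (h1 h))
    ρ_α := fun i n h x => ?_
    f_α := fun i n h h' x => ?_
    f_ρ := fun i n h h' x => ?_
    α_mem := fun i n h x hx => ?_
    ρ_mem := fun i n h x hx => ?_ }⟩
  · match i, h, x with
    | 0, h, x => exact μ.ρ_α 0 (n + 1) (h1 h) x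
    | i + 1, h, (x, y) =>
      exact Prod.ext (LinearMap.congr_fun (hba i n (h2 h)) x) (μ.ρ_α (i + 1) (n + 1) (h1 h) y)
  · match i, h, h', x with
    | 0, h, h', x => exact Prod.ext rfl (hα 0 (n + 1) (h1 h) (h1 h') x).symm
    | i + 1, h, h', x =>
      exact Prod.ext (map_zero (a i n (h2 h))).symm (hα (i + 1) (n + 1) (h1 h) (h1 h') x).symm
  · match i, h, h', x with
    | 0, h, h', x => exact (hρ 0 (n + 1) (h1 h) (h1 h') x).symm
    | i + 1, h, h', x =>
      exact Prod.ext (map_zero (b i n (h2 h))).symm (hρ (i + 1) (n + 1) (h1 h) (h1 h') x).symm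
  · match i, h, x, hx with
    | 0, h, x, hx =>
      obtain rfl : x = 0 := hx
      rw [map_zero]
      exact Submodule.zero_mem _
    | i + 1, h, x, hx =>
      have hx1 : D.q i x.1 = 0 := hx.1
      have hx2 : x.2 = 0 := hx.2
      refine ⟨?_, ?_⟩
      · exact (LinearMap.congr_fun (ha i n (h2 h)) x.1).trans (by
          rw [LinearMap.comp_apply, hx1, map_zero])
      · change μ.α (i + 1) (n + 1) (h1 h) x.2 = 0
        rw [hx2, map_zero]
  · have hx1 : C.q n x.1 = 0 := hx.1
    have hx2 : x.2 = 0 := hx.2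
    match i, h with
    | 0, h =>
      change μ.ρ 0 (n + 1) (h1 h) x.2 = 0
      rw [hx2, map_zero]
    | i + 1, h =>
      refine ⟨?_, ?_⟩
      · exact (LinearMap.congr_fun (hb i n (h2 h)) x.1).trans (by
          rw [LinearMap.comp_apply, hx1, map_zero])
      · change μ.ρ (i + 1) (n + 1) (h1 h) x.2 = 0
        rw [hx2, map_zero]

end Marking

/-- The resolution of length `1` given by a projective cover. -/
def ofCover {P N : FGModuleCat.{u} Λ} (p : P →ₗ[Λ] N) (hp : IsModuleProjectiveCover p) :
    ResolutionData N 1 where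
  P
    | 0 => P
    | _ + 1 => FGModuleCat.of Λ PUnit
  P_eq_zero i hi := by
    obtain ⟨i, rfl⟩ : ∃ k, i = k + 1 := ⟨i - 1, by omega⟩
    exact inferInstanceAs (Subsingleton PUnit)
  ε := p
  f _ := 0
  Q
    | 0 => LinearMap.ker p
    | _ + 1 => ⊥
  ε_cover := hp
  f_cover i := by
    have : Module.Projective Λ PUnit.{u + 1} := inferInstance
    exact isModuleProjectiveCover_rangeRestrict (A := PUnit) (fun U _ => Subsingleton.elim _ _)
  disjoint i := by
    rw [LinearMap.range_zero]
    exact disjoint_bot_right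
  ker_ε := by rw [LinearMap.range_zero, sup_bot_eq]
  ker_f i := Subsingleton.elim (α := Submodule Λ PUnit.{u + 1}) _ _

variable [IsArtinianRing Λ] {M : FGModuleCat.{u} Λ} {m : ℕ} {T : ResolutionData M m}

namespace SummandCovers

/-- The identification of `P_{Q_k}` and `P_{Q_n}` for `k = n`. -/
def castPQ (C : T.SummandCovers) {k n : ℕ} (h : k = n) : C.PQ k ≃ₗ[Λ] C.PQ n :=
  h ▸ LinearEquiv.refl Λ (C.PQ k)

/-- The starting point for the iteration: `PQ k` is the first factor of the projective at index `k`,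
with ΩQ as its split-off part. The differentials of `syzygyData` land in second factors, so the
projection kills them, matching the zero differential of `ofCover`. -/
lemma nonempty_marking (C : T.SummandCovers) (k : ℕ) :
    Nonempty (Marking C.syzygyData k
      (ofCover (N := FGModuleCat.of Λ (T.Q k)) (C.q k) (C.q_cover k))) := by
  have h0 : ∀ {n}, n = k + 0 → k = n := fun h => by omega
  refine ⟨{
    α := fun i n h => match i, h with
      | 0, h => show C.PQ k →ₗ[Λ] C.PQ n × T.P (n + 1) from
        LinearMap.inl Λ _ _ ∘ₗ (C.castPQ (h0 h)).toLinearMap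
      | i + 1, _ => 0
    ρ := fun i n h => match i, h with
      | 0, h => show C.PQ n × T.P (n + 1) →ₗ[Λ] C.PQ k from
        (C.castPQ (h0 h)).symm.toLinearMap ∘ₗ LinearMap.fst Λ _ _
      | i + 1, _ => 0
    ρ_α := fun i n h x => ?_
    f_α := fun i n h h' x => ?_
    f_ρ := fun i n h h' x => ?_
    α_mem := fun i n h x hx => ?_
    ρ_mem := fun i n h x hx => ?_ }⟩
  · match i, h, x with
    | 0, h, x => exact (C.castPQ (h0 h)).symm_apply_apply x
    | i + 1, h, x => exact Subsingleton.elim (α := PUnit) _ _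
  · exact (map_zero _).trans (map_zero _).symm
  · match i, h with
    | 0, h => exact (map_zero (C.castPQ (h0 h)).symm).symm
    | i + 1, h => rfl
  · match i, h, x, hx with
    | 0, h, x, hx =>
      obtain rfl := h0 h
      exact ⟨hx, rfl⟩
    | i + 1, h, x, hx => exact Submodule.zero_mem _
  · match i, h with
    | 0, h =>
      obtain rfl := h0 h
      exact hx.1
    | i + 1, h => exact Submodule.zero_mem _

lemma subsingleton_PQ_of_Q_eq_bot (C : T.SummandCovers) {i : ℕ} (h : T.Q i = ⊥) :
    Subsingleton (C.PQ i) := by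
  have : Subsingleton (T.Q i) := by rw [h]; infer_instance
  have hb : (⊥ : Submodule Λ (C.PQ i)) = ⊤ := (C.q_cover i).superfluous ⊥ (by
    rw [bot_sup_eq, eq_top_iff]
    exact fun x _ => Subsingleton.elim _ _)
  exact (Submodule.subsingleton_iff Λ).mp (subsingleton_of_bot_eq_top hb)

/-- Zero summands have zero covers, so prolonging pushes the first possibly nonzero summand one
index further. -/
lemma prolong_Q_eq_bot (C : T.SummandCovers) {i : ℕ} (h : ∀ l < i, T.Q l = ⊥) :
    ∀ l < i + 1, C.prolong.Q l = ⊥ := by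
  intro l hl
  match l with
  | 0 => rfl
  | l + 1 =>
    have := C.subsingleton_PQ_of_Q_eq_bot (h l (by omega))
    change ((LinearMap.ker (C.q l)).prod ⊥ : Submodule Λ (C.PQ l × T.P (l + 1))) = ⊥
    rw [Subsingleton.elim (LinearMap.ker (C.q l)) ⊥, Submodule.prod_bot]

end SummandCovers

lemma nonempty_iso_of_isSyzygy {S S' : Cb Λ} (C : T.SummandCovers) (h : IsSyzygy S S')
    (e : S' ≅ T.complex) : Nonempty (S ≅ C.syzygyData.complex) := by
  obtain ⟨P, p, i, hp, hi⟩ := h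
  obtain ⟨e'⟩ := nonempty_iso_of_isProjectiveCover hp hi C.isProjectiveCover_coverMap
    C.isKernelOf_syzygyMap e
  obtain ⟨e''⟩ := C.nonempty_syzygy_iso
  exact ⟨e' ≪≫ e''⟩

/-- Each syzygy lowers the marking index from `k - i` by one and prolongs the resolution of `T.Q k`
by one. The bound `i ≤ k` ensures that the index is still positive before each step. -/
lemma exists_marking_of_isIteratedSyzygy (C : T.SummandCovers) (k i : ℕ) (hi : i ≤ k) (S : Cb Λ)
    (hS : IsIteratedSyzygy (i + 1) S T.complex) :
    ∃ (M' : FGModuleCat.{u} Λ) (T' : ResolutionData M' m)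
      (E : ResolutionData (FGModuleCat.of Λ (T.Q k)) (i + 1)),
      Nonempty (S ≅ T'.complex) ∧ (∀ l < i, E.Q l = ⊥) ∧ Nonempty (Marking T' (k - i) E) := by
  induction i generalizing S with
  | zero =>
    obtain ⟨S', ⟨e⟩, hS'⟩ := hS
    exact ⟨_, C.syzygyData, ofCover (C.q k) (C.q_cover k), nonempty_iso_of_isSyzygy C hS' e,
      fun l hl => absurd hl (Nat.not_lt_zero l), C.nonempty_marking k⟩
  | succ i ih =>
    obtain ⟨S', hS', hSS'⟩ := hS
    obtain ⟨M', T', E, ⟨e⟩, hE, ⟨μ⟩⟩ := ih (by omega) S' hS'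
    obtain ⟨C'⟩ := T'.nonempty_summandCovers
    obtain ⟨D⟩ := E.nonempty_summandCovers
    obtain ⟨j, hj⟩ : ∃ j, k - i = j + 1 := ⟨k - (i + 1), by omega⟩
    rw [hj] at μ
    refine ⟨_, C'.syzygyData, D.prolong, nonempty_iso_of_isSyzygy C' hSS' e,
      D.prolong_Q_eq_bot hE, ?_⟩
    rw [show k - (i + 1) = j by omega]
    exact μ.nonempty_syzygy C' D

/-- The minimal projective resolution of `Q_{k+1}`, truncated without split-off summands before
the last term, is a direct summand of the `k+1`-st syzygies. -/
lemma exists_retract_of_isIteratedSyzygy (C : T.SummandCovers) (k : ℕ) (S : Cb Λ)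
    (hS : IsIteratedSyzygy (k + 1) S T.complex) :
    ∃ E : ResolutionData (FGModuleCat.of Λ (T.Q k)) (k + 1),
      (∀ l < k, E.Q l = ⊥) ∧ Nonempty (Retract E.complex S) := by
  obtain ⟨M', T', E, ⟨e⟩, hE, ⟨μ⟩⟩ := exists_marking_of_isIteratedSyzygy C k k le_rfl S hS
  rw [Nat.sub_self] at μ
  obtain ⟨r⟩ := μ.nonempty_retract
  exact ⟨E, hE, ⟨r.trans (Retract.ofIso e.symm)⟩⟩

end Marking

end ResolutionData

/-! ### Projective dimension -/

section ProjectiveDimension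

set_option linter.unusedSectionVars false

variable {Λ : Type u} [Ring Λ] [IsArtinianRing Λ]

lemma FGModuleCat.projective_iff (N : FGModuleCat.{u} Λ) :
    Projective N ↔ Module.Projective Λ N := by
  constructor
  · intro h
    obtain ⟨P, p, hp⟩ := exists_isModuleProjectiveCover N
    let p' : P ⟶ N := FGModuleCat.ofHom p
    have : Epi p' := FGModuleCat.epi_of_surjective p' hp.surjective
    have := hp.projective
    exact Module.Projective.of_split (Projective.factorThru (𝟙 N) p').hom.hom p
      (congrArg (fun k => k.hom.hom) (Projective.factorThru_comp (𝟙 N) p'))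
  · intro h
    refine ⟨fun {E X} f e he => ?_⟩
    obtain ⟨k, hk⟩ := Module.projective_lifting_property e.hom.hom f.hom.hom
      (FGModuleCat.surjective_of_epi e)
    exact ⟨FGModuleCat.ofHom k, FGModuleCat.hom_ext hk⟩

/-- Dimension shifting along ker p → P → N. It would fail one step lower, since a projective `N`
need not have zero kernel. -/
lemma hasProjectiveDimensionLT_iff_ker {P N : FGModuleCat.{u} Λ} (p : P →ₗ[Λ] N)
    (hp : Function.Surjective p) (hP : Module.Projective Λ P) (n : ℕ) :
    HasProjectiveDimensionLT N (n + 2) ↔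
      HasProjectiveDimensionLT (FGModuleCat.of Λ (LinearMap.ker p)) (n + 1) := by
  let i : FGModuleCat.of Λ (LinearMap.ker p) ⟶ P := FGModuleCat.ofHom (LinearMap.ker p).subtype
  let p' : P ⟶ N := FGModuleCat.ofHom p
  have h0 : i ≫ p' = 0 := FGModuleCat.hom_ext (LinearMap.ext fun x => x.2)
  have : Epi p' := FGModuleCat.epi_of_surjective p' hp
  have : Mono i := ⟨fun a b hab => FGModuleCat.hom_ext (LinearMap.ext fun x =>
    Subtype.ext (LinearMap.congr_fun (congrArg (fun k => k.hom.hom) hab) x))⟩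
  have hl : IsLimit (KernelFork.ofι i h0) := KernelFork.IsLimit.ofι i h0
    (fun k hk => FGModuleCat.ofHom (k.hom.hom.codRestrict (LinearMap.ker p) fun x =>
      LinearMap.congr_fun (congrArg (fun l => l.hom.hom) hk : (k ≫ p').hom.hom = 0) x))
    (fun k hk => rfl)
    (fun k hk b hb => by rw [← cancel_mono i, hb]; rfl)
  have hS : (ShortComplex.mk i p' h0).ShortExact :=
    { exact := ShortComplex.exact_of_f_is_kernel _ hl
      mono_f := ‹_›
      epi_g := ‹_› }
  exact hS.hasProjectiveDimensionLT_X₃_iff n ((FGModuleCat.projective_iff P).mpr hP)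

lemma hasProjectiveDimensionLT_of_submodule_eq {P : FGModuleCat.{u} Λ} {A B : Submodule Λ P}
    (h : A = B) {n : ℕ} (hA : HasProjectiveDimensionLT (FGModuleCat.of Λ A) n) :
    HasProjectiveDimensionLT (FGModuleCat.of Λ B) n := h ▸ hA

/-- The summands of an internal direct sum are retracts of it. -/
lemma nonempty_retract_sup {P : FGModuleCat.{u} Λ} {A B : Submodule Λ P} (h : Disjoint A B) :
    Nonempty (Retract (FGModuleCat.of Λ A) (FGModuleCat.of Λ (A ⊔ B : Submodule Λ P))) := by
  let s : (A × B) →ₗ[Λ] (A ⊔ B : Submodule Λ P) :=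
    (Submodule.inclusion le_sup_left).coprod (Submodule.inclusion le_sup_right)
  have hs : Function.Surjective s := by
    rintro ⟨x, hx⟩
    obtain ⟨a, ha, b, hb, rfl⟩ := Submodule.mem_sup.mp hx
    exact ⟨(⟨a, ha⟩, ⟨b, hb⟩), rfl⟩
  obtain ⟨r, hr⟩ := exists_comp_eq_of_ker_le hs (LinearMap.fst Λ A B) (by
    rintro ⟨a, b⟩ hab
    have hab : (a : P) + b = 0 := congrArg Subtype.val hab
    refine Subtype.ext ((Submodule.disjoint_def.mp h) a a.2 ?_)
    rw [eq_neg_of_add_eq_zero_left hab]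
    exact B.neg_mem b.2)
  refine ⟨⟨FGModuleCat.ofHom (Submodule.inclusion le_sup_left), FGModuleCat.ofHom r,
    FGModuleCat.hom_ext (LinearMap.ext fun a => ?_)⟩⟩
  have h1 : s (a, 0) = Submodule.inclusion le_sup_left a := by simp [s]
  change r (Submodule.inclusion le_sup_left a) = a
  rw [← h1]
  exact LinearMap.congr_fun hr (a, 0)

namespace ResolutionData

variable {M : FGModuleCat.{u} Λ} {m : ℕ} (T : ResolutionData M m)

/-- The syzygy `Q_{i+1} ⊕ R_{i+1}`, a submodule of `P_i`. -/
def Z (i : ℕ) : Submodule Λ (T.P i) := T.Q i ⊔ LinearMap.range (T.f i)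

lemma hasProjectiveDimensionLT_iff_Z_zero (n : ℕ) :
    HasProjectiveDimensionLT M (n + 2) ↔
      HasProjectiveDimensionLT (FGModuleCat.of Λ (T.Z 0)) (n + 1) := by
  rw [hasProjectiveDimensionLT_iff_ker T.ε T.ε_cover.surjective T.ε_cover.projective, Z, T.ker_ε]

lemma hasProjectiveDimensionLT_range_f_iff (i n : ℕ) :
    HasProjectiveDimensionLT (FGModuleCat.of Λ (LinearMap.range (T.f i))) (n + 2) ↔
      HasProjectiveDimensionLT (FGModuleCat.of Λ (T.Z (i + 1))) (n + 1) := by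
  have h : LinearMap.ker (T.f i).rangeRestrict = T.Z (i + 1) := by
    rw [LinearMap.ker_rangeRestrict, Z, T.ker_f]
  rw [hasProjectiveDimensionLT_iff_ker (N := FGModuleCat.of Λ (LinearMap.range (T.f i)))
    (T.f i).rangeRestrict (T.f_cover i).surjective (T.f_cover i).projective]
  exact ⟨hasProjectiveDimensionLT_of_submodule_eq h,
    hasProjectiveDimensionLT_of_submodule_eq h.symm⟩

/-- The range of `f i` is a direct summand of `Z i`, so it inherits the bound; passing to the kernel
of its cover, which is `Z (i + 1)`, lowers the bound by one. -/
lemma hasProjectiveDimensionLT_Z (i n : ℕ)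
    (h : HasProjectiveDimensionLT (FGModuleCat.of Λ (T.Z 0)) (n + 1 + i)) :
    HasProjectiveDimensionLT (FGModuleCat.of Λ (T.Z i)) (n + 1) := by
  induction i generalizing n with
  | zero => exact h
  | succ i ih =>
    have h1 := ih (n + 1) (by rwa [show n + 1 + 1 + i = n + 1 + (i + 1) by omega])
    obtain ⟨r⟩ := nonempty_retract_sup (T.disjoint i).symm
    rw [← T.hasProjectiveDimensionLT_range_f_iff]
    have := hasProjectiveDimensionLT_of_submodule_eq (sup_comm _ _) h1
    exact r.hasProjectiveDimensionLT _

/-- Without split-off summands `Z i` equals the range of `f i`, so the dimension shifts can be run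
backwards. -/
lemma hasProjectiveDimensionLT_Z_zero (i n : ℕ) (hQ : ∀ l < i, T.Q l = ⊥)
    (h : HasProjectiveDimensionLT (FGModuleCat.of Λ (T.Z i)) (n + 1)) :
    HasProjectiveDimensionLT (FGModuleCat.of Λ (T.Z 0)) (n + 1 + i) := by
  induction i generalizing n with
  | zero => exact h
  | succ i ih =>
    have h1 := ih (n + 1) (fun l hl => hQ l (by omega))
      (hasProjectiveDimensionLT_of_submodule_eq (A := LinearMap.range (T.f i))
        (by rw [Z, hQ i (Nat.lt_succ_self i), bot_sup_eq])
        ((T.hasProjectiveDimensionLT_range_f_iff i n).mpr h))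
    rwa [show n + 1 + 1 + i = n + 1 + (i + 1) by omega] at h1

lemma projective_Q_of_Z_zero (i : ℕ)
    (h : HasProjectiveDimensionLT (FGModuleCat.of Λ (T.Z 0)) (i + 1)) :
    Module.Projective Λ (T.Q i) := by
  have h1 := T.hasProjectiveDimensionLT_Z i 0 (by rwa [show 0 + 1 + i = i + 1 by omega])
  obtain ⟨r⟩ := nonempty_retract_sup (T.disjoint i)
  have : HasProjectiveDimensionLT
    (FGModuleCat.of Λ (T.Q i ⊔ LinearMap.range (T.f i) : Submodule Λ (T.P i))) (0 + 1) := h1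
  have h2 := r.hasProjectiveDimensionLT (0 + 1)
  exact (FGModuleCat.projective_iff (FGModuleCat.of Λ (T.Q i))).mp
    (projective_iff_hasProjectiveDimensionLT_one.mpr h2)

/-- A resolution without split-off summands before the last term is a truncated projective
resolution if the module has sufficiently large projective dimension. -/
lemma isTruncatedResolution_of_Q_eq_bot {k : ℕ} (E : ResolutionData M (k + 1))
    (hQ : ∀ l < k, E.Q l = ⊥) (hpd : ((k + 1 : ℕ) : WithBot ℕ∞) ≤ projectiveDimension M) :
    E.IsTruncatedResolution := by
  refine ⟨Nat.succ_pos k, hpd, fun i hi hf => ?_⟩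
  rw [projectiveDimension_ge_iff] at hpd
  -- If the range of `f i` vanished, the syzygy `Z i` would be zero and `M` would have projective
  -- dimension at most `i + 1`, which is below `k + 1`.
  have hz : E.Z i = ⊥ := by rw [Z, hQ i (by omega), hf, sup_bot_eq]
  have h1 : HasProjectiveDimensionLT (FGModuleCat.of Λ (E.Z i)) (0 + 1) := by
    rw [← projective_iff_hasProjectiveDimensionLT_one, FGModuleCat.projective_iff]
    have : Subsingleton (E.Z i) := by rw [hz]; infer_instance
    exact inferInstanceAs (Module.Projective Λ (E.Z i))
  have h2 := E.hasProjectiveDimensionLT_Z_zero i 0 (fun l hl => hQ l (by omega)) h1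
  rw [show 0 + 1 + i = i + 1 by omega, ← E.hasProjectiveDimensionLT_iff_Z_zero] at h2
  exact hpd (hasProjectiveDimensionLT_of_ge M (i + 2) (k + 1) (by omega))

end ResolutionData

end ProjectiveDimension

namespace ResolutionData

/-! ### Removing the last projective -/

section Shorten

set_option linter.unusedSectionVars false

variable {Λ : Type u} [Ring Λ] [IsArtinianRing Λ] {M : FGModuleCat.{u} Λ} {m : ℕ}
  (T : ResolutionData M (m + 1))

/-- The part of `P_i` which is kept: everything for `i < m`, and nothing for `i ≥ m`. -/
def W (i : ℕ) : Submodule Λ (T.P i) := if i < m then ⊤ else ⊥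

lemma mem_W {i : ℕ} (hi : i < m) (x : T.P i) : x ∈ T.W i := by
  rw [W, if_pos hi]
  exact Submodule.mem_top

lemma subsingleton_W {i : ℕ} (hi : m ≤ i) : Subsingleton (T.W i) := by
  rw [W, if_neg (by omega)]
  infer_instance

lemma f_mem_W (i : ℕ) (x : T.P (i + 1)) (hx : x ∈ T.W (i + 1)) : T.f i x ∈ T.W i := by
  by_cases hi : i < m
  · exact T.mem_W hi _
  · have := T.subsingleton_W (i := i + 1) (by omega)
    have h : (⟨x, hx⟩ : T.W (i + 1)) = 0 := Subsingleton.elim _ _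
    obtain rfl : x = 0 := congrArg Subtype.val h
    rw [map_zero]
    exact Submodule.zero_mem _

/-- The restriction of `f` to the parts which are kept. -/
def fW (i : ℕ) : T.W (i + 1) →ₗ[Λ] T.W i := (T.f i).restrict (T.f_mem_W i)

/-- The split-off summands of the shortened resolution. -/
def QW (i : ℕ) : Submodule Λ (T.W i) :=
  (if i + 1 < m then T.Q i else T.Q i ⊔ LinearMap.range (T.f i)).comap (T.W i).subtype

lemma mem_QW_of_lt {i : ℕ} (hi : i + 1 < m) {x : T.W i} : x ∈ T.QW i ↔ (x : T.P i) ∈ T.Q i := by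
  rw [QW, if_pos hi]; rfl

lemma mem_QW_of_ge {i : ℕ} (hi : m ≤ i + 1) {x : T.W i} :
    x ∈ T.QW i ↔ (x : T.P i) ∈ T.Q i ⊔ LinearMap.range (T.f i) := by
  rw [QW, if_neg (by omega)]; rfl

/-- Enlarging the summand at the last kept index compensates for the range lost with the discarded
projective, so the exactness conditions for `shorten` reduce to those of `T`. -/
lemma mem_QW_sup_range (i : ℕ) (x : T.W i) :
    x ∈ T.QW i ⊔ LinearMap.range (T.fW i) ↔ (x : T.P i) ∈ T.Q i ⊔ LinearMap.range (T.f i) := by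
  by_cases hi : i + 1 < m
  · constructor
    · intro h
      obtain ⟨y, hy, _, ⟨z, rfl⟩, rfl⟩ := Submodule.mem_sup.mp h
      exact Submodule.mem_sup.mpr ⟨y, (T.mem_QW_of_lt hi).mp hy, _, ⟨z, rfl⟩, rfl⟩
    · intro h
      obtain ⟨y, hy, _, ⟨z, rfl⟩, hx⟩ := Submodule.mem_sup.mp h
      exact Submodule.mem_sup.mpr ⟨⟨y, T.mem_W (by omega) y⟩, (T.mem_QW_of_lt hi).mpr hy, _,
        ⟨⟨z, T.mem_W hi z⟩, rfl⟩, Subtype.ext hx⟩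
  · have := T.subsingleton_W (i := i + 1) (by omega)
    have h0 : LinearMap.range (T.fW i) = ⊥ := by
      rw [LinearMap.range_eq_bot]
      exact LinearMap.ext fun z => by rw [Subsingleton.elim z 0, map_zero, map_zero]
    rw [h0, sup_bot_eq]
    exact T.mem_QW_of_ge (by omega)

lemma projective_W (i : ℕ) : Module.Projective Λ (T.W i) := by
  by_cases hi : i < m
  · have := T.projective_P i
    rw [W, if_pos hi]
    exact Module.Projective.of_equiv Submodule.topEquiv.symm
  · have := T.subsingleton_W (i := i) (by omega)
    infer_instance

lemma isSuperfluous_comap_W {i : ℕ} {N : Submodule Λ (T.P i)} (h : IsSuperfluous N) :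
    IsSuperfluous (N.comap (T.W i).subtype) := by
  by_cases hi : i < m
  · refine (h.map (LinearMap.codRestrict (T.W i) LinearMap.id (T.mem_W hi))).mono ?_
    exact fun x hx => ⟨x, hx, rfl⟩
  · have := T.subsingleton_W (i := i) (by omega)
    exact fun U _ => Subsingleton.elim _ _

lemma ker_fW (i : ℕ) : LinearMap.ker (T.fW i) = (LinearMap.ker (T.f i)).comap (T.W _).subtype := by
  ext x
  exact ⟨fun h => congrArg Subtype.val h, fun h => Subtype.ext h⟩

/-- The resolution of length `m` obtained from one of length `m + 1` by regarding the last syzygy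
in degree `m - 1` as a split-off summand. -/
def shorten (hm : 0 < m) : ResolutionData M m where
  P i := FGModuleCat.of Λ (T.W i)
  P_eq_zero i hi := T.subsingleton_W hi
  ε := T.ε ∘ₗ (T.W 0).subtype
  f := T.fW
  Q := T.QW
  ε_cover := by
    refine ⟨T.projective_W 0, fun y => ?_, ?_⟩
    · obtain ⟨x, rfl⟩ := T.ε_cover.surjective y
      exact ⟨⟨x, T.mem_W hm x⟩, rfl⟩
    · rw [LinearMap.ker_comp]
      exact T.isSuperfluous_comap_W T.ε_cover.superfluous
  f_cover i := by
    have := T.projective_W (i + 1)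
    refine isModuleProjectiveCover_rangeRestrict ?_
    rw [ker_fW]
    exact T.isSuperfluous_comap_W (T.isSuperfluous_ker_f i)
  disjoint i := by
    rw [Submodule.disjoint_def]
    rintro _ hx ⟨z, rfl⟩
    by_cases hi : i + 1 < m
    · exact Subtype.ext ((Submodule.disjoint_def.mp (T.disjoint i)) _
        ((T.mem_QW_of_lt hi).mp hx) ⟨z, rfl⟩)
    · have := T.subsingleton_W (i := i + 1) (by omega)
      rw [Subsingleton.elim z 0, map_zero]
  ker_ε := by
    ext x
    refine (T.mem_QW_sup_range 0 x).trans ?_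
    rw [T.ker_ε]
    rfl
  ker_f i := by
    ext x
    refine (T.mem_QW_sup_range (i + 1) x).trans ?_
    rw [T.ker_f, ker_fW]
    rfl

/-- The projection of `P_i` to the part which is kept. -/
def toW (i : ℕ) : T.P i →ₗ[Λ] T.W i :=
  if hi : i < m then LinearMap.codRestrict (T.W i) LinearMap.id (T.mem_W hi) else 0

lemma coe_toW {i : ℕ} (hi : i < m) (x : T.P i) : (T.toW i x : T.P i) = x := by
  rw [toW, dif_pos hi]; rfl

/-- The difference of `x + f y` and the part of it which comes from the projective kept. -/
def restW (i : ℕ) : (T.Q i × T.P (i + 1)) →ₗ[Λ] T.P i :=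
  (T.Q i).subtype.coprod (T.f i ∘ₗ (LinearMap.id - (T.W (i + 1)).subtype ∘ₗ T.toW (i + 1)))

lemma restW_add (i : ℕ) (x : T.Q i) (y : T.P (i + 1)) :
    T.restW i (x, y) + T.f i (T.toW (i + 1) y) = (x : T.P i) + T.f i y := by
  simp only [restW, LinearMap.coprod_apply, LinearMap.comp_apply, LinearMap.sub_apply, map_sub,
    LinearMap.id_apply, Submodule.subtype_apply]
  abel

lemma restW_of_lt {i : ℕ} (hi : i + 1 < m) (x : T.Q i) (y : T.P (i + 1)) :
    T.restW i (x, y) = x := by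
  simp [restW, T.coe_toW hi]

lemma restW_of_ge {i : ℕ} (hi : m ≤ i + 1) (x : T.Q i) (y : T.P (i + 1)) :
    T.restW i (x, y) = (x : T.P i) + T.f i y := by
  have : T.toW (i + 1) y = 0 := by rw [toW, dif_neg (by omega), LinearMap.zero_apply]
  simp [restW, this]

lemma toW_restW_mem (i : ℕ) (x : T.Q i × T.P (i + 1)) : T.toW i (T.restW i x) ∈ T.QW i := by
  by_cases hi : i < m
  · by_cases hi' : i + 1 < m
    · rw [T.mem_QW_of_lt hi', T.coe_toW hi, T.restW_of_lt hi']
      exact x.1.2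
    · rw [T.mem_QW_of_ge (by omega), T.coe_toW hi, T.restW_of_ge (by omega)]
      exact Submodule.mem_sup.mpr ⟨_, x.1.2, _, ⟨x.2, rfl⟩, rfl⟩
  · have := T.subsingleton_W (i := i) (by omega)
    rw [Subsingleton.elim (T.toW i _) 0]
    exact Submodule.zero_mem _

/-- The comparison of `Q_k ⊕ P_k` with the corresponding term of the shortened resolution. -/
def shortenMap (i : ℕ) : (T.Q i × T.P (i + 1)) →ₗ[Λ] (T.QW i × T.W (i + 1)) :=
  LinearMap.prod (LinearMap.codRestrict (T.QW i) (T.toW i ∘ₗ T.restW i) (T.toW_restW_mem i))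
    (T.toW (i + 1) ∘ₗ LinearMap.snd Λ _ _)

/-- Only index `m - 1` has content: there the map is essentially `(x, y) ↦ x + f y`, injective
because the sum is direct and because `Q m` and `P (m + 1)` vanish, which makes `f (m - 1)`
injective. At smaller indices it is the identity, and at larger ones both sides are zero. -/
lemma shortenMap_bijective (hQ : T.Q m = ⊥) (i : ℕ) : Function.Bijective (T.shortenMap i) := by
  have := T.P_eq_zero
  by_cases hi : i < m
  · by_cases hi' : i + 1 < m
    · constructor
      · rw [← LinearMap.ker_eq_bot, LinearMap.ker_eq_bot']
        rintro ⟨x, y⟩ h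
        have h1 : T.toW i (T.restW i (x, y)) = 0 := congrArg (fun t => (t.1 : T.W i)) h
        have h2 : T.toW (i + 1) y = 0 := congrArg Prod.snd h
        have h3 := congrArg Subtype.val h1
        have h4 := congrArg Subtype.val h2
        rw [T.coe_toW hi, T.restW_of_lt hi'] at h3
        rw [T.coe_toW hi'] at h4
        exact Prod.ext (Subtype.ext h3) h4
      · rintro ⟨w, v⟩
        refine ⟨(⟨w.1, (T.mem_QW_of_lt hi').mp w.2⟩, v.1), Prod.ext (Subtype.ext (Subtype.ext ?_))
          (Subtype.ext (T.coe_toW hi' _))⟩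
        exact (T.coe_toW hi _).trans (T.restW_of_lt hi' _ _)
    · have hker : LinearMap.ker (T.f i) = ⊥ := by
        obtain rfl : m = i + 1 := by omega
        have := T.P_eq_zero (i + 2) (by omega)
        rw [← T.ker_f, hQ, bot_sup_eq, LinearMap.range_eq_bot]
        exact LinearMap.ext fun z => by rw [Subsingleton.elim z 0, map_zero, map_zero]
      have := T.subsingleton_W (i := i + 1) (by omega)
      constructor
      · rw [← LinearMap.ker_eq_bot, LinearMap.ker_eq_bot']
        rintro ⟨x, y⟩ h
        have h1 : T.toW i (T.restW i (x, y)) = 0 := congrArg (fun t => (t.1 : T.W i)) h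
        have h3 := congrArg Subtype.val h1
        rw [T.coe_toW hi, T.restW_of_ge (by omega)] at h3
        have h3 : (x : T.P i) + T.f i y = 0 := h3
        have hx : (x : T.P i) = 0 := (Submodule.disjoint_def.mp (T.disjoint i)) _ x.2
          ⟨-y, by rw [map_neg]; exact (eq_neg_of_add_eq_zero_left h3).symm⟩
        rw [hx, zero_add] at h3
        exact Prod.ext (Subtype.ext hx) (LinearMap.ker_eq_bot'.mp hker y h3)
      · rintro ⟨w, v⟩
        obtain ⟨x, hx, _, ⟨y, rfl⟩, hxy⟩ :=
          Submodule.mem_sup.mp ((T.mem_QW_of_ge (by omega)).mp w.2)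
        refine ⟨(⟨x, hx⟩, y), Prod.ext (Subtype.ext (Subtype.ext ?_)) (Subsingleton.elim _ _)⟩
        exact (T.coe_toW hi _).trans ((T.restW_of_ge (by omega) _ _).trans hxy)
  · have := T.subsingleton_W (i := i) (by omega)
    have := T.subsingleton_W (i := i + 1) (by omega)
    have := T.P_eq_zero (i + 1) (by omega)
    have : Subsingleton (T.Q i) := by
      rcases Nat.lt_or_ge m i with h | h
      · exact T.Q_subsingleton i (by omega)
      · obtain rfl : i = m := by omega
        rw [hQ]
        infer_instance
    exact ⟨Function.injective_of_subsingleton _, Function.surjective_to_subsingleton _⟩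

lemma nonempty_shorten_iso (hm : 0 < m) (hQ : T.Q m = ⊥) :
    Nonempty (T.complex ≅ (T.shorten hm).complex) := by
  have hW : ∀ (i : ℕ) (x : T.Q i) (y : T.P (i + 1)),
      T.toW i (T.restW i (x, y)) + T.fW i (T.toW (i + 1) y) = T.toW i ((x : T.P i) + T.f i y) := by
    intro i x y
    by_cases hi : i < m
    · refine Subtype.ext ?_
      rw [T.coe_toW hi, Submodule.coe_add, T.coe_toW hi, ← T.restW_add]
      rfl
    · have := T.subsingleton_W (i := i) (by omega)
      exact Subsingleton.elim _ _
  refine Cb.nonempty_iso_of_bijective (fun n => match n with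
    | 0 => LinearMap.id
    | 1 => T.toW 0
    | k + 2 => T.shortenMap k) (fun n => ?_) (fun n => ?_)
  · match n with
    | 0 => exact fun x => congrArg T.ε (T.coe_toW hm x)
    | 1 => exact fun x => hW 0 x.1 x.2
    | k + 2 =>
      rintro ⟨x, y⟩
      refine Prod.ext (Subtype.ext ?_) (hW (k + 1) x y)
      change 0 = T.toW k (T.restW k ((0 : T.Q k), (x : T.P (k + 1)) + T.f (k + 1) y))
      -- From the last kept index on, `restW` applies `f` to its second argument, here already an
      -- image of the differential.
      have h0 : T.restW k ((0 : T.Q k), (x : T.P (k + 1)) + T.f (k + 1) y) = 0 := by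
        by_cases hk : k + 1 < m
        · exact T.restW_of_lt hk _ _
        · rw [T.restW_of_ge (by omega), map_add, T.f_Q, T.f_f, add_zero, add_zero]
          rfl
      rw [h0, map_zero]
  · match n with
    | 0 => exact Function.bijective_id
    | 1 =>
      exact ⟨fun x y h => ((T.coe_toW hm x).symm.trans (congrArg Subtype.val h)).trans
          (T.coe_toW hm y),
        fun w => ⟨w.1, Subtype.ext (T.coe_toW hm _)⟩⟩
    | k + 2 => exact T.shortenMap_bijective hQ k

end Shorten

end ResolutionData

namespace ResolutionData

/-! ### The syzygy as a truncated projective resolution -/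

section SyzygyResolution

set_option linter.unusedSectionVars false

variable {Λ : Type u} [Ring Λ] [IsArtinianRing Λ] {M : FGModuleCat.{u} Λ}

/-- Projective dimension of ΩM below `m` would make the last summand projective by dimension
shifting. A vanishing range in `syzygyData` forces `Q (i + 1)` and the range of `f (i + 1)` to
vanish: the latter is excluded while `i + 2 < m`, and for `i + 2 = m` the former makes Q_m = 0
projective. -/
lemma IsTruncatedResolution.syzygyData_of_not_projective {m : ℕ} {T : ResolutionData M m}
    (hT : T.IsTruncatedResolution) (C : T.SummandCovers)
    (hQ : ¬ Module.Projective Λ (T.Q (m - 1))) : C.syzygyData.IsTruncatedResolution := by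
  have hm := hT.pos
  refine ⟨hm, ?_, fun i hi hf => ?_⟩
  · rw [projectiveDimension_ge_iff]
    intro h
    refine hQ (T.projective_Q_of_Z_zero (m - 1) ?_)
    rw [show m - 1 + 1 = m by omega]
    exact hasProjectiveDimensionLT_of_submodule_eq T.ker_ε.symm h
  · have h1 : LinearMap.range (C.iqf (i + 1)) = ⊥ := by
      rw [LinearMap.range_eq_bot, ← LinearMap.ker_eq_top] at hf ⊢
      rwa [← ker_inr_comp (A := C.PQ i) (C.iqf (i + 1))]
    rw [C.range_iqf, sup_eq_bot_iff] at h1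
    by_cases hi' : i + 2 < m
    · exact hT.R_ne_zero (i + 1) hi' h1.2
    · refine hQ ?_
      rw [show m - 1 = i + 1 by omega, h1.1]
      infer_instance

/-- The cover of a projective module splits, and the range of the section supplements the
superfluous kernel, so the section is onto. -/
lemma SummandCovers.ker_q_eq_bot {m : ℕ} {T : ResolutionData M m} (C : T.SummandCovers) {i : ℕ}
    (hQ : Module.Projective Λ (T.Q i)) : LinearMap.ker (C.q i) = ⊥ := by
  obtain ⟨s, hs⟩ := Module.projective_lifting_property (C.q i) LinearMap.id
    (C.q_cover i).surjective
  have hqs : ∀ y, C.q i (s y) = y := LinearMap.congr_fun hs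
  have htop : LinearMap.range s = ⊤ := (C.q_cover i).superfluous _ (eq_top_iff.mpr fun x _ =>
    Submodule.mem_sup.mpr ⟨s (C.q i x), ⟨_, rfl⟩, x - s (C.q i x), by
      rw [LinearMap.mem_ker, map_sub, hqs, sub_self], by abel⟩)
  rw [LinearMap.ker_eq_bot']
  intro x hx
  obtain ⟨y, rfl⟩ := LinearMap.range_eq_top.mp htop x
  rw [hqs] at hx
  rw [hx, map_zero]

lemma SummandCovers.syzygyData_Q_eq_bot {m : ℕ} {T : ResolutionData M m} (C : T.SummandCovers)
    {i : ℕ} (hQ : Module.Projective Λ (T.Q i)) : C.syzygyData.Q i = ⊥ := by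
  change (LinearMap.ker (C.q i)).prod ⊥ = ⊥
  rw [C.ker_q_eq_bot hQ, Submodule.prod_bot]

variable {n : ℕ} {T : ResolutionData M (n + 2)}

/-- The dimension condition is a single shift from `M` to ΩM, and the differentials that survive
still contain the nonzero maps `f (i + 1)` of `T`. -/
lemma IsTruncatedResolution.shorten_syzygyData (hT : T.IsTruncatedResolution)
    (C : T.SummandCovers) :
    (C.syzygyData.shorten (Nat.succ_pos n)).IsTruncatedResolution := by
  refine ⟨Nat.succ_pos n, ?_, fun i hi hf => ?_⟩
  · have h := hT.le_pd
    rw [projectiveDimension_ge_iff] at h ⊢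
    exact fun h' => h ((hasProjectiveDimensionLT_iff_ker T.ε T.ε_cover.surjective
      T.ε_cover.projective n).mpr h')
  · refine hT.R_ne_zero (i + 1) (by omega) ?_
    rw [LinearMap.range_eq_bot]
    refine LinearMap.ext fun y => ?_
    have h1 := LinearMap.congr_fun (LinearMap.range_eq_bot.mp hf)
      ⟨((0 : C.PQ (i + 1)), y), C.syzygyData.mem_W hi _⟩
    have h2 : C.iqf (i + 1) (0, y) = 0 :=
      congrArg (fun t => (t : C.PQ i × T.P (i + 1)).2) (congrArg Subtype.val h1)
    simpa [SummandCovers.iqf] using h2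

lemma W_eq_top {m : ℕ} (T : ResolutionData M (m + 1)) {i : ℕ} (hi : i < m) : T.W i = ⊤ :=
  if_pos hi

/-- The split-off summands of the shortened resolution before the last one are unchanged. -/
def QWEquivOfLt {m : ℕ} (T : ResolutionData M (m + 1)) {i : ℕ} (hi : i + 1 < m) :
    T.QW i ≃ₗ[Λ] T.Q i :=
  (LinearEquiv.ofEq _ _ (by rw [QW, if_pos hi])).trans
    (Submodule.comapSubtypeEquivOfLe (fun x _ => T.mem_W (by omega) x))

/-- The last split-off summand of the shortened resolution. -/
def QWEquivLast {m : ℕ} (T : ResolutionData M (m + 2)) :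
    T.QW m ≃ₗ[Λ] (T.Q m ⊔ LinearMap.range (T.f m) : Submodule Λ (T.P m)) :=
  (LinearEquiv.ofEq _ _ (by rw [QW, if_neg (Nat.lt_irrefl _)])).trans
    (Submodule.comapSubtypeEquivOfLe (fun x _ => T.mem_W (by omega) x))

/-- The range absorbed by shortening is that of `iqf (n + 1)`, which is just `T.Q (n + 1)` because
`P (n + 2)` is zero. -/
lemma SummandCovers.nonempty_last_equiv (C : T.SummandCovers) :
    Nonempty (C.syzygyData.QW n ≃ₗ[Λ] LinearMap.ker (C.q n) × T.Q (n + 1)) := by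
  have h1 : LinearMap.range (C.iqf (n + 1)) = T.Q (n + 1) := by
    have := T.P_eq_zero (n + 2) le_rfl
    rw [C.range_iqf, LinearMap.range_eq_bot.mpr, sup_bot_eq]
    exact LinearMap.ext fun x => by rw [Subsingleton.elim x 0, map_zero, map_zero]
  have h2 : C.syzygyData.Q n ⊔ LinearMap.range (C.syzygyData.f n) =
      (LinearMap.ker (C.q n)).prod (T.Q (n + 1)) :=
    (prod_bot_sup_range_inr_comp _ _).trans (congrArg (Submodule.prod _) h1)
  let N : Submodule Λ (C.PQ n × T.P (n + 1)) := (LinearMap.ker (C.q n)).prod (T.Q (n + 1))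
  let e : C.syzygyData.QW n ≃ₗ[Λ] N :=
    C.syzygyData.QWEquivLast.trans (LinearEquiv.ofEq (M := C.syzygyData.P n) _ _ h2)
  exact ⟨e.trans (submoduleProdEquiv _ _)⟩

/-- Here `P 1` and ΩQ_1 are zero, so the cover of ΩM is bijective and itself serves as the
comparison in degree 0. -/
lemma SummandCovers.nonempty_iso_identityComplex {T : ResolutionData M 1} (C : T.SummandCovers)
    (hQ : Module.Projective Λ (T.Q 0)) : Nonempty (C.syzygy ≅ identityComplex T.syzygyModule) := by
  have hP : ∀ i, Subsingleton (T.P (i + 1)) := fun i => T.P_eq_zero (i + 1) (by omega)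
  have hPQ : ∀ i, Subsingleton (C.PQ (i + 1)) := fun i => C.PQ_subsingleton (i + 1) (by omega)
  have hker : ∀ i, Subsingleton (LinearMap.ker (C.q i)) := by
    intro i
    rcases i with _ | i
    · rw [C.ker_q_eq_bot hQ]
      infer_instance
    · infer_instance
  have hX : ∀ k, Subsingleton (C.syzygyX (k + 2)) := fun k =>
    inferInstanceAs (Subsingleton (LinearMap.ker (C.q k) × (C.PQ (k + 1) × T.P (k + 2))))
  refine Cb.nonempty_iso_of_bijective (fun n => match n with
    | 0 => LinearMap.id
    | 1 => C.syzygyε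
    | k + 2 => 0) (fun n => ?_) (fun n => ?_)
  · match n with
    | 0 => exact fun x => rfl
    | k + 1 =>
      intro x
      rw [Subsingleton.elim x 0]
      simp only [map_zero]
  · match n with
    | 0 => exact Function.bijective_id
    | 1 =>
      refine ⟨?_, C.syzygyε_cover.surjective⟩
      change Function.Injective C.syzygyε
      rw [← LinearMap.ker_eq_bot, C.ker_syzygyε, C.ker_iqf, C.ker_q_eq_bot hQ,
        Subsingleton.elim (LinearMap.ker (T.f 0)) ⊥, Submodule.prod_bot]
    | k + 2 =>
      have : Subsingleton (FGModuleCat.of Λ PUnit.{u + 1}) :=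
        inferInstanceAs (Subsingleton PUnit)
      exact ⟨Function.injective_of_subsingleton _, fun y => ⟨0, Subsingleton.elim (α := PUnit) _ _⟩⟩

end SyzygyResolution

end ResolutionData

end

/-! ### The main theorem. -/

theorem mainTheorem3 {Λ : Type u} [Ring Λ] [IsArtinianRing Λ] {M : FGModuleCat.{u} Λ} {m : ℕ}
    (T : ResolutionData M m) (hT : T.IsTruncatedResolution) (C : T.SummandCovers) :
    -- `g : P_X → X` is a projective cover of `X` in `C^b(Λ)`, and `h : Ω X → P_X` is its kernel
    IsProjectiveCover C.coverMap ∧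
    IsKernelOf C.syzygyMap C.coverMap ∧
    -- if `Q_m` is not projective, `Ω X` is a truncated projective resolution of `Ω M` of length `m`
    (¬ Module.Projective Λ (T.Q (m - 1)) →
      ∃ T' : ResolutionData T.syzygyModule m, T'.IsTruncatedResolution ∧
        Nonempty (C.syzygy ≅ T'.complex) ∧
        (∀ i, i < m → Nonempty (T'.P i ≃ₗ[Λ] C.PQ i × T.P (i + 1))) ∧
        (∀ i, i < m → Nonempty (T'.Q i ≃ₗ[Λ] LinearMap.ker (C.q i)))) ∧
    -- if `Q_m` is projective and `m ≥ 2`, it is one of length `m - 1`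
    (Module.Projective Λ (T.Q (m - 1)) → 2 ≤ m →
      ∃ T' : ResolutionData T.syzygyModule (m - 1), T'.IsTruncatedResolution ∧
        Nonempty (C.syzygy ≅ T'.complex) ∧
        (∀ i, i + 1 < m → Nonempty (T'.P i ≃ₗ[Λ] C.PQ i × T.P (i + 1))) ∧
        (∀ i, i + 2 < m → Nonempty (T'.Q i ≃ₗ[Λ] LinearMap.ker (C.q i))) ∧
        Nonempty (T'.Q (m - 2) ≃ₗ[Λ] LinearMap.ker (C.q (m - 2)) × T.Q (m - 1))) ∧
    -- if `m = 1` and `Q_1` is projective, it is the one of length `0`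
    (Module.Projective Λ (T.Q (m - 1)) → m = 1 →
      Nonempty (C.syzygy ≅ identityComplex T.syzygyModule)) ∧
    -- `Q_1 ← P_{Q_1} ← Ω Q_1` is a direct summand of `Ω X`
    (∃ T' : ResolutionData (FGModuleCat.of Λ (T.Q 0)) 1,
      (∃ e : T'.P 0 ≃ₗ[Λ] C.PQ 0, C.q 0 ∘ₗ e.toLinearMap = T'.ε) ∧
        Nonempty (Retract T'.complex C.syzygy)) ∧
    -- for `1 ≤ k + 1 ≤ m`, the minimal projective resolution of `Q_{k+1}`, truncated at length
    -- `k + 1` without split-off summands before the last term, is a direct summand of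
    -- `Ω^{k+1} X`; if `pd Q_{k+1} ≥ k + 1`, it is a truncated projective resolution
    (∀ k, k < m → ∀ S : Cb Λ, IsIteratedSyzygy (k + 1) S T.complex →
      ∃ T' : ResolutionData (FGModuleCat.of Λ (T.Q k)) (k + 1),
        (∀ i, i < k → T'.Q i = ⊥) ∧
        Nonempty (Retract T'.complex S) ∧
        (((k + 1 : ℕ) : WithBot ℕ∞) ≤ projectiveDimension (FGModuleCat.of Λ (T.Q k)) →
          T'.IsTruncatedResolution)) := by
  refine ⟨C.isProjectiveCover_coverMap, C.isKernelOf_syzygyMap, fun hQ => ?_, fun hQ hm => ?_,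
    fun hQ hm => ?_, ?_, fun k _ S hS => ?_⟩
  · exact ⟨C.syzygyData, hT.syzygyData_of_not_projective C hQ, C.nonempty_syzygy_iso,
      fun i _ => ⟨LinearEquiv.refl Λ _⟩, fun i _ => ⟨(prodBotEquiv _).symm⟩⟩
  · obtain ⟨n, rfl⟩ : ∃ n, m = n + 2 := ⟨m - 2, by omega⟩
    obtain ⟨e⟩ := C.nonempty_syzygy_iso
    -- Projectivity of Q_m gives ΩQ_m = 0, the vanishing of the last summand which shortening
    -- requires.
    obtain ⟨e'⟩ := C.syzygyData.nonempty_shorten_iso (Nat.succ_pos n) (C.syzygyData_Q_eq_bot hQ)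
    exact ⟨C.syzygyData.shorten (Nat.succ_pos n), hT.shorten_syzygyData C, ⟨e ≪≫ e'⟩,
      fun i hi => ⟨LinearEquiv.ofTop _ (C.syzygyData.W_eq_top (by omega))⟩,
      fun i hi => ⟨(C.syzygyData.QWEquivOfLt (by omega)).trans (prodBotEquiv _).symm⟩,
      C.nonempty_last_equiv⟩
  · subst hm
    exact C.nonempty_iso_identityComplex hQ
  · obtain ⟨μ⟩ := C.nonempty_marking 0
    obtain ⟨r⟩ := μ.nonempty_retract
    obtain ⟨e⟩ := C.nonempty_syzygy_iso
    exact ⟨_, ⟨LinearEquiv.refl Λ _, rfl⟩, ⟨r.trans (Retract.ofIso e.symm)⟩⟩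
  · obtain ⟨E, hE, hr⟩ := ResolutionData.exists_retract_of_isIteratedSyzygy C k S hS
    exact ⟨E, hE, hr, E.isTruncatedResolution_of_Q_eq_bot hE⟩
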